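/- **Setting.** There are $n_{ip}$ interest points, $n_t$ thermals and $n_g$ gliders in the plane $\mathbb R^2$. Thermal $t_k$ gives height $h_{t_k}>0$. Glider $i$ has a start position $p^0_i$, a start orientation $\theta^0_i\in[-\pi,\pi]$, a start height $h^0_i>0$ and a final position $p^f_i$. All gliders have the angle of descent $\gamma_d\in(0,\pi/2)$, maximal curvature $\kappa>0$ and maximal sharpness $\sigma>0$. **Legs.** Put $\theta_{lim}=\kappa^2/\sigma$ and $$x_\Omega=\int_0^{\kappa/\sigma}\cos\tfrac{\sigma u^2}{2}\,du-\tfrac1\kappa\sin\tfrac{\theta_{lim}}2,\qquad y_\Omega=\int_0^{\kappa/\sigma}\sin\tfrac{\sigma u^2}{2}\,du+\tfrac1\kappa\cos\tfrac{\theta_{lim}}2,$$ $R_T=\sqrt{x_\Omega^2+y_\Omega^2}$, $\gamma=\arctan(x_\Omega/y_\Omega)$, $R_M=R_T\cos\gamma$. The leg from a position $p$ with orientation $\theta$ to a goal $g$ is a continuous-curvature (CC) turn towards the side on which $g$ lies (to the left if $g$ lies on the line through $p$ in direction $\theta$), followed by a segment that ends at $g$. In coordinates in which $p$ is the origin, $\theta=0$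 and (after a reflection, if necessary) $g$ lies in the closed upper half plane, let $v=g-(x_\Omega,y_\Omega)$ and $l^i=\|v\|$. The turn changes the orientation by the angle $\beta\in[0,2\pi)$ congruent to $\arg v+\arcsin(R_M/l^i)$ modulo $2\pi$. It has arclength $$l^{cc}(\beta)=\begin{cases}2R_T\sin\gamma&\beta=0,\\ 2\sqrt{\beta/\sigma_e}&0<\beta<\theta_{lim},\\ \beta/\kappa+\kappa/\sigma&\beta\ge\theta_{lim},\end{cases}\qquad \sigma_e=\beta\left(\frac{\int_0^1\cos\big(\tfrac\beta2(1-s^2)\big)ds}{R_T\sin(\beta/2+\gamma)}\right)^{2},$$ and the leg has arclength $l^f=\sqrt{(l^i)^2-R_M^2}-R_T\sin\gamma+l^{cc}(\beta)$; its final orientation is $\theta+\beta$ for a left turn and $\theta-\beta$ for a right turn. **Visitation orders.** An allocation $\xi$ to glider $i$ is a set of interest points. The nodes of the graph $\Gamma_L(\xi)$ are finite sequences $\lambda$. The root is the empty sequence, and the children of a node are obtained by appending an element of $\xi\cup\{t_1,\dots,t_{n_t}\}\cup\{f\}$ that it does not contain yet, where $f$ stands for the final position of glider $i$. Goal nodes,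 those whose last entry is $f$, have no children. The composite path of $\lambda$ starts at $p^0_i$ with orientation $\theta^0_i$ and consists of the legs to the successive waypoints of $\lambda$, each leg starting at the waypoint and with the orientation where the previous one ended; $S_L(\lambda)$ is its total arclength. Let $K_L(\lambda,\xi)$ be the cardinality of $\xi$ minus the number of interest points in $\lambda$, and $$S_L^{max}(\lambda)=\frac{h^0_i+\sum_{k:\,t_k\in\lambda}h_{t_k}}{\tan\gamma_d},\qquad P_L=\frac{h^0_i+\sum_k h_{t_k}+1}{\tan\gamma_d}.$$ Let $l_{min}$ be the smallest distance between any two of the interest points, thermals, start positions and final positions, and let $$\mathcal R_{max}=\frac{\sqrt{(l_{min}+R_T)^2-R_M^2}}{l_{min}}+\frac{\max\left(\frac{\beta_{max}}{\kappa}+\frac{\kappa}{\sigma},\ \frac{4.66R_T}{l_{min}}\right)+R_T}{l_{min}},\qquad \beta_{max}=\pi+2\arctan\frac{R_M}{l_{min}+R_T\sin\gamma}.$$ A node is *valid* (*weakly valid*) if it and all its ancestors except the root satisfy $S_L<S_L^{max}$ (respectively $S_L/\mathcal R_{max}<S_L^{max}$). A goal node has cost $V_L=S_L+K_LP_L$ and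 weak cost $\underline V_L=S_L/\mathcal R_{max}+K_LP_L$. An *optimal* order for $\xi$ is a valid goal node with the least cost, and a *weakly optimal* order is a weakly valid goal node with the least weak cost. **Sets of allocations.** The nodes of the graph $\Gamma_U$ are families $\Xi=(\xi_i)_{i\le n_g}$ of allocations. The root is the family of empty sets, and a child of $\Xi$ is obtained by adding one interest point that lies in none of the $\xi_i$ to one of them. With optimal orders $\lambda_i$ and weakly optimal orders $\underline\lambda_i$ for $\xi_i$, the cost and the weak cost of $\Xi$ are $$\mathbb V_U(\Xi)=\sum_i S_L(\lambda_i)+P_U\sum_iK_L(\lambda_i,\xi_i),\qquad \underline{\mathbb V}_U(\Xi)=\sum_i\underline V_L(\underline\lambda_i,\xi_i),\qquad P_U=\frac{\sum_ih^0_i+\sum_kh_{t_k}+1}{\tan\gamma_d}.$$ **Theorem.** Assume $\theta_{lim}<\pi$ and $l_{min}>2R_T$. Let $\Xi'$ be a node of $\Gamma_U$, and let $\Xi''$ be a descendant (child, child of child, ...) of $\Xi'$ whose cost is defined, that is, an optimal order exists for each allocation of $\Xi''$. Then the weak cost of $\Xi'$ is defined as well, and $$\underline{\mathbb V}_U(\Xi')\le\mathbb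 V_U(\Xi''),$$ whichever optimal and weakly optimal orders are used to compute the two sides. -/

import Mathlib

namespace Soaring

/-! The horizontal plane `ℝ²` is identified with `ℂ`; the norm of `ℂ` is the Euclidean norm. -/

noncomputable section

section Turn

/-! Continuous curvature (CC) turns for maximal curvature `κ` and maximal sharpness `σ`. -/

variable (κ σ : ℝ)

/-- The limit deflection `θ_lim`. -/
def thetaLim : ℝ := κ ^ 2 / σ

/-- First coordinate of the centre of the circle on which CC turns to the left end, for a turn that
starts at the origin in direction `(1, 0)`. A clothoid of sharpness `σ` is followed until
the curvature reaches `κ`; the centre is that of the osculating circle at this point. -/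
def centerX : ℝ := (∫ u in (0 : ℝ)..(κ / σ), Real.cos (σ * u ^ 2 / 2)) - Real.sin (thetaLim κ σ / 2) / κ

/-- Second coordinate of that centre. -/
def centerY : ℝ := (∫ u in (0 : ℝ)..(κ / σ), Real.sin (σ * u ^ 2 / 2)) + Real.cos (thetaLim κ σ / 2) / κ

/-- The radius `R_T` of the circle on which CC turns start and end. -/
def turnRadius : ℝ := Real.sqrt (centerX κ σ ^ 2 + centerY κ σ ^ 2)

/-- The angle `γ` between the path and the tangent to that circle at both ends of a CC turn. -/
def turnGamma : ℝ := Real.arctan (centerX κ σ / centerY κ σ)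

/-- The radius `R_M` of the concentric circle that is tangent to the lines that continue a turn. -/
def innerRadius : ℝ := turnRadius κ σ * Real.cos (turnGamma κ σ)

/-- Distance between the endpoints, divided by length, of two symmetric clothoids which
turn by `β` altogether. -/
def chordRatio (β : ℝ) : ℝ := ∫ s in (0 : ℝ)..1, Real.cos (β / 2 * (1 - s ^ 2))

/-- The sharpness `σ_e` of the two clothoids of a turn by `β < θ_lim`: the one for which the turn
ends on the circle of radius `R_T`. -/
def turnSharpness (β : ℝ) : ℝ :=
  β * (chordRatio β / (turnRadius κ σ * Real.sin (β / 2 + turnGamma κ σ))) ^ 2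

/-- The arclength `l^cc` of a CC turn by `β`. For `β = 0` the turn degenerates to
the segment that crosses the circle of radius `R_T`. -/
def turnLength (β : ℝ) : ℝ :=
  if β = 0 then 2 * turnRadius κ σ * Real.sin (turnGamma κ σ)
  else if β < thetaLim κ σ then 2 * Real.sqrt (β / turnSharpness κ σ β)
  else β / κ + κ / σ

/-- The curvature profile of a leg that begins with a CC turn by `β` to the left. -/
def legCurvature (β l : ℝ) : ℝ :=
  if turnLength κ σ β < l then 0
  else if β < thetaLim κ σ then
    if l ≤ turnLength κ σ β / 2 then turnSharpness κ σ β * l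
    else turnSharpness κ σ β * (turnLength κ σ β - l)
  else
    if l ≤ κ / σ then σ * l
    else if l ≤ turnLength κ σ β - κ / σ then κ
    else σ * (turnLength κ σ β - l)

end Turn

section Leg

/-! The leg which starts at `p` with orientation `θ` and leads to the goal `g`: a CC turn, followed
by a segment. -/

variable (κ σ : ℝ) (p : ℂ) (θ : ℝ) (g : ℂ)

/-- The goal in coordinates in which the leg starts at the origin in direction `(1, 0)`. -/
def relGoal : ℂ := (g - p) * Complex.exp (-(θ * Complex.I))

/-- The sense of the turn: `1` (to the left) or `-1` (to the right), towards the side of the goal. -/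
def turnSide : ℝ := if 0 ≤ (relGoal p θ g).im then 1 else -1

/-- The vector from the centre of the turning circle to the goal, after a reflection that puts
the goal on the left hand side. Its norm is the distance `l^i`. -/
def centerToGoal : ℂ :=
  ⟨(relGoal p θ g).re - centerX κ σ, |(relGoal p θ g).im| - centerY κ σ⟩

/-- The change of orientation `β ∈ [0, 2π)` after which the path points to the goal. -/
def legTurn : ℝ :=
  toIcoMod Real.two_pi_pos 0
    (Complex.arg (centerToGoal κ σ p θ g)
      + Real.arcsin (innerRadius κ σ / ‖centerToGoal κ σ p θ g‖))

/-- The arclength `l^f = l^s - R_T sin γ + l^cc` of the leg, where `l^s` is the length of the tangent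
from the goal to the circle of radius `R_M`. -/
def legLength : ℝ :=
  Real.sqrt (‖centerToGoal κ σ p θ g‖ ^ 2 - innerRadius κ σ ^ 2)
    - turnRadius κ σ * Real.sin (turnGamma κ σ)
    + turnLength κ σ (legTurn κ σ p θ g)

/-- The orientation at the end of the leg. -/
def legEndHeading : ℝ := θ + turnSide p θ g * legTurn κ σ p θ g

/-- The orientation at arclength `l`, obtained from the curvature profile. -/
def legHeading (l : ℝ) : ℝ :=
  θ + turnSide p θ g * ∫ u in (0 : ℝ)..l, legCurvature κ σ (legTurn κ σ p θ g) u

/-- The position at arclength `l`. -/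
def legPath (l : ℝ) : ℂ :=
  p + ∫ u in (0 : ℝ)..l, Complex.exp (legHeading κ σ p θ g u * Complex.I)

end Leg

section Lemmas

/-! Helper facts that justify the definitions above; the last one is the conclusion. -/

open MeasureTheory intervalIntegral

variable {κ σ : ℝ}

lemma centerY_pos (hκ : 0 < κ) (hσ : 0 < σ) (hθ : thetaLim κ σ < Real.pi) :
    0 < centerY κ σ := by
  have h0 : 0 < thetaLim κ σ := by unfold thetaLim; positivity
  unfold centerY
  refine add_pos_of_nonneg_of_pos ?_ (div_pos (Real.cos_pos_of_mem_Ioo ⟨by linarith, by linarith⟩) hκ)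
  refine integral_nonneg (by positivity) fun u hu => ?_
  have : σ * u ^ 2 / 2 ≤ thetaLim κ σ / 2 := by
    have h1 : u ^ 2 ≤ (κ / σ) ^ 2 := pow_le_pow_left₀ hu.1 hu.2 2
    have h2 : σ * (κ / σ) ^ 2 = thetaLim κ σ := by unfold thetaLim; field_simp
    nlinarith
  have h3 : 0 ≤ σ * u ^ 2 / 2 := by positivity
  exact Real.sin_nonneg_of_nonneg_of_le_pi h3 (by linarith)

lemma centerX_nonneg (hκ : 0 < κ) (hσ : 0 < σ) (hθ : thetaLim κ σ < Real.pi) :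
    0 ≤ centerX κ σ := by
  have h2 : σ * (κ / σ) ^ 2 = thetaLim κ σ := by unfold thetaLim; field_simp
  have h0 : 0 < thetaLim κ σ := by unfold thetaLim; positivity
  have hs : ∫ u in (0 : ℝ)..(κ / σ), (σ * u / κ) * Real.cos (σ * u ^ 2 / 2)
      = Real.sin (thetaLim κ σ / 2) / κ := by
    rw [integral_eq_sub_of_hasDerivAt (f := fun u => Real.sin (σ * u ^ 2 / 2) / κ)]
    · simp [h2]
    · intro u _
      have h : HasDerivAt (fun u : ℝ => σ * u ^ 2 / 2) (σ * u) u := by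
        refine (((hasDerivAt_pow 2 u).const_mul σ).div_const 2).congr_deriv ?_
        norm_num
        ring
      exact (h.sin.div_const κ).congr_deriv (by ring)
    · exact (by fun_prop : Continuous fun u : ℝ => (σ * u / κ) * Real.cos (σ * u ^ 2 / 2)).intervalIntegrable _ _
  unfold centerX
  rw [← hs, ← integral_sub
    ((by fun_prop : Continuous fun u : ℝ => Real.cos (σ * u ^ 2 / 2)).intervalIntegrable _ _)
    ((by fun_prop : Continuous fun u : ℝ => (σ * u / κ) * Real.cos (σ * u ^ 2 / 2)).intervalIntegrable _ _)]
  refine integral_nonneg (by positivity) fun u hu => ?_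
  have h1 : u ^ 2 ≤ (κ / σ) ^ 2 := pow_le_pow_left₀ hu.1 hu.2 2
  have h3 : 0 ≤ σ * u ^ 2 / 2 := by positivity
  have hc : 0 ≤ Real.cos (σ * u ^ 2 / 2) :=
    Real.cos_nonneg_of_mem_Icc ⟨by linarith [Real.pi_pos], by nlinarith⟩
  have hu1 : σ * u / κ ≤ 1 := by
    rw [div_le_one hκ]
    have := (le_div_iff₀ hσ).1 hu.2
    linarith
  nlinarith

lemma turnRadius_pos (hκ : 0 < κ) (hσ : 0 < σ) (hθ : thetaLim κ σ < Real.pi) :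
    0 < turnRadius κ σ := by
  have := centerY_pos hκ hσ hθ
  unfold turnRadius
  positivity

lemma innerRadius_eq (hκ : 0 < κ) (hσ : 0 < σ) (hθ : thetaLim κ σ < Real.pi) :
    innerRadius κ σ = centerY κ σ := by
  have hy := centerY_pos hκ hσ hθ
  have h : 1 + (centerX κ σ / centerY κ σ) ^ 2
      = (centerX κ σ ^ 2 + centerY κ σ ^ 2) / centerY κ σ ^ 2 := by field_simp; ring
  have hr := turnRadius_pos hκ hσ hθ
  unfold innerRadius turnGamma
  rw [Real.cos_arctan, h, Real.sqrt_div' _ (by positivity), Real.sqrt_sq hy.le]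
  change turnRadius κ σ * (1 / (turnRadius κ σ / centerY κ σ)) = _
  field_simp

lemma turnRadius_sin (hκ : 0 < κ) (hσ : 0 < σ) (hθ : thetaLim κ σ < Real.pi) :
    turnRadius κ σ * Real.sin (turnGamma κ σ) = centerX κ σ := by
  have hy := centerY_pos hκ hσ hθ
  have h1 := innerRadius_eq hκ hσ hθ
  have h2 : Real.tan (turnGamma κ σ) = centerX κ σ / centerY κ σ := Real.tan_arctan _
  have h3 : Real.cos (turnGamma κ σ) ≠ 0 := (Real.cos_arctan_pos _).ne'
  rw [Real.tan_eq_sin_div_cos, div_eq_div_iff h3 hy.ne', ← h1, innerRadius] at h2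
  have : Real.cos (turnGamma κ σ) *
      (turnRadius κ σ * Real.sin (turnGamma κ σ)) = Real.cos (turnGamma κ σ) * centerX κ σ := by
    linarith
  exact mul_left_cancel₀ h3 this

/-- A curvature profile which is symmetric about `m`. -/
lemma turn_symm {c : ℝ → ℝ} (hc : Continuous c) (m : ℝ) (hsym : ∀ u, c (2 * m - u) = c u) :
    (∫ u in (0 : ℝ)..(2 * m), c u) = 2 * ∫ u in (0 : ℝ)..m, c u := by
  have h1 := integral_add_adjacent_intervals (hc.intervalIntegrable (μ := volume) 0 m)
    (hc.intervalIntegrable m (2 * m))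
  have h2 : ∫ u in m..(2 * m), c u = ∫ u in (0 : ℝ)..m, c u := by
    have := integral_comp_sub_left (a := 0) (b := m) c (2 * m)
    simp only [hsym] at this
    rw [this]; congr 1 <;> ring
  rw [← h1, h2]; ring

lemma turn_symm' {c : ℝ → ℝ} (hc : Continuous c) (m : ℝ) (hsym : ∀ u, c (2 * m - u) = c u)
    (Θ : ℝ → ℝ) (hΘ : ∀ u, Θ u = ∫ t in (0 : ℝ)..u, c t) :
    (∫ u in (0 : ℝ)..(2 * m), Complex.exp (Θ u * Complex.I))
      = 2 * Complex.exp (Θ m * Complex.I) * ((∫ u in (0 : ℝ)..m, Real.cos (Θ u - Θ m) : ℝ) : ℂ) := by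
  have hcont : Continuous Θ := by
    have : Θ = fun u => ∫ t in (0 : ℝ)..u, c t := funext hΘ
    rw [this]
    exact continuous_primitive (fun a b => hc.intervalIntegrable a b) 0
  have hrefl : ∀ u, Θ (2 * m - u) = 2 * Θ m - Θ u := by
    intro u
    have h1 := integral_add_adjacent_intervals (hc.intervalIntegrable (μ := volume) 0 (2 * m - u))
      (hc.intervalIntegrable (2 * m - u) (2 * m))
    have h2 : ∫ t in (2 * m - u)..(2 * m), c t = ∫ t in (0 : ℝ)..u, c t := by
      have := integral_comp_sub_left (a := 0) (b := u) c (2 * m)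
      simp only [hsym] at this
      rw [this]; congr 1; ring
    have h3 := turn_symm hc m hsym
    rw [hΘ, hΘ, hΘ]
    linarith
  have hE : Continuous fun u => Complex.exp (Θ u * Complex.I) := by fun_prop
  have h1 := integral_add_adjacent_intervals (hE.intervalIntegrable (μ := volume) 0 m)
    (hE.intervalIntegrable m (2 * m))
  have h2 : ∫ u in m..(2 * m), Complex.exp (Θ u * Complex.I)
      = ∫ u in (0 : ℝ)..m, Complex.exp ((2 * Θ m - Θ u : ℝ) * Complex.I) := by
    have := integral_comp_sub_left (a := 0) (b := m) (fun u => Complex.exp (Θ u * Complex.I)) (2 * m)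
    simp only [hrefl] at this
    rw [this]; congr 1 <;> ring
  have hE' : Continuous fun u => Complex.exp ((2 * Θ m - Θ u : ℝ) * Complex.I) := by fun_prop
  rw [← h1, h2, ← integral_add (hE.intervalIntegrable _ _) (hE'.intervalIntegrable _ _),
    ← intervalIntegral.integral_ofReal, ← intervalIntegral.integral_const_mul]
  refine integral_congr fun u _ => ?_
  simp only [Complex.ofReal_cos, Complex.cos]
  have : ∀ x y z : ℂ, x = y + z → Complex.exp x = Complex.exp y * Complex.exp z := by
    rintro x y z rfl; exact Complex.exp_add y z
  rw [this (Θ u * Complex.I) (Θ m * Complex.I) ((Θ u - Θ m : ℝ) * Complex.I) (by push_cast; ring),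
    this ((2 * Θ m - Θ u : ℝ) * Complex.I) (Θ m * Complex.I) (-(Θ u - Θ m : ℝ) * Complex.I)
      (by push_cast; ring)]
  push_cast
  ring

lemma chordRatio_pos {β : ℝ} (h0 : 0 < β) (h1 : β < Real.pi) : 0 < chordRatio β := by
  refine intervalIntegral_pos_of_pos_on
    ((by fun_prop : Continuous fun s : ℝ => Real.cos (β / 2 * (1 - s ^ 2))).intervalIntegrable _ _)
    (fun s hs => ?_) one_pos
  have h2 : 0 < 1 - s ^ 2 := by nlinarith [hs.1, hs.2]
  have h3 : 1 - s ^ 2 ≤ 1 := by nlinarith [sq_nonneg s]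
  refine Real.cos_pos_of_mem_Ioo ⟨?_, ?_⟩
  · have : 0 < β / 2 * (1 - s ^ 2) := by positivity
    linarith [Real.pi_pos]
  · nlinarith

lemma sin_turn_pos (hκ : 0 < κ) (hσ : 0 < σ) (hθ : thetaLim κ σ < Real.pi) {β : ℝ} (h0 : 0 < β)
    (h1 : β < Real.pi) : 0 < Real.sin (β / 2 + turnGamma κ σ) := by
  have h2 : 0 ≤ turnGamma κ σ :=
    Real.arctan_nonneg.2 (div_nonneg (centerX_nonneg hκ hσ hθ) (centerY_pos hκ hσ hθ).le)
  have h3 : turnGamma κ σ < Real.pi / 2 := Real.arctan_lt_pi_div_two _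
  exact Real.sin_pos_of_pos_of_lt_pi (by linarith) (by linarith)

lemma turnSharpness_pos (hκ : 0 < κ) (hσ : 0 < σ) (hθ : thetaLim κ σ < Real.pi) {β : ℝ} (h0 : 0 < β)
    (h1 : β < thetaLim κ σ) : 0 < turnSharpness κ σ β := by
  have := sin_turn_pos hκ hσ hθ h0 (h1.trans hθ)
  have := chordRatio_pos h0 (h1.trans hθ)
  have := turnRadius_pos hκ hσ hθ
  unfold turnSharpness
  positivity

lemma turnLength_nonneg (hκ : 0 < κ) (hσ : 0 < σ) (hθ : thetaLim κ σ < Real.pi) {β : ℝ}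
    (h0 : 0 ≤ β) : 0 ≤ turnLength κ σ β := by
  unfold turnLength
  split_ifs
  · rw [mul_assoc, turnRadius_sin hκ hσ hθ]
    have := centerX_nonneg hκ hσ hθ
    positivity
  · positivity
  · positivity

/-- The orientation after a turn and the displacement during the turn. -/
lemma turn_end (hκ : 0 < κ) (hσ : 0 < σ) (hθ : thetaLim κ σ < Real.pi) {β : ℝ} (h0 : 0 ≤ β) :
    (∫ u in (0 : ℝ)..(turnLength κ σ β), legCurvature κ σ β u) = β ∧
    (∫ u in (0 : ℝ)..(turnLength κ σ β),
      Complex.exp (((∫ t in (0 : ℝ)..u, legCurvature κ σ β t : ℝ) : ℂ) * Complex.I))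
      = ((2 * turnRadius κ σ * Real.sin (β / 2 + turnGamma κ σ) : ℝ) : ℂ)
        * Complex.exp ((β / 2 : ℝ) * Complex.I) := by
  have hl := turnLength_nonneg hκ hσ hθ h0
  have hth : 0 < thetaLim κ σ := by unfold thetaLim; positivity
  -- it suffices to treat a continuous symmetric profile that agrees with the given one
  suffices H : ∃ c : ℝ → ℝ, Continuous c ∧ (∀ u, c (turnLength κ σ β - u) = c u) ∧
      (∀ u, 0 ≤ u → u ≤ turnLength κ σ β → legCurvature κ σ β u = c u) ∧
      ∃ Θ : ℝ → ℝ, (∀ u, 0 ≤ u → u ≤ turnLength κ σ β / 2 → (∫ t in (0 : ℝ)..u, c t) = Θ u) ∧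
        Θ (turnLength κ σ β / 2) = β / 2 ∧
        (∫ u in (0 : ℝ)..(turnLength κ σ β / 2), Real.cos (Θ u - β / 2))
          = turnRadius κ σ * Real.sin (β / 2 + turnGamma κ σ) by
    obtain ⟨c, hc, hsym, heq, Θ, hΘ, hm, hint⟩ := H
    set m := turnLength κ σ β / 2 with hmdef
    have h2m : turnLength κ σ β = 2 * m := by rw [hmdef]; ring
    have hm0 : 0 ≤ m := by positivity
    rw [h2m] at heq hsym ⊢
    have hI : ∀ u, 0 ≤ u → u ≤ 2 * m →
        (∫ t in (0 : ℝ)..u, legCurvature κ σ β t) = ∫ t in (0 : ℝ)..u, c t := by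
      intro u hu hu'
      refine integral_congr fun t ht => ?_
      rw [Set.uIcc_of_le hu] at ht
      exact heq t ht.1 (ht.2.trans hu')
    have hmm : (∫ t in (0 : ℝ)..m, c t) = β / 2 := by rw [hΘ m hm0 le_rfl, hm]
    constructor
    · rw [hI _ (by positivity) le_rfl, turn_symm hc m hsym, hmm]; ring
    · have h1 : (∫ u in (0 : ℝ)..(2 * m),
          Complex.exp (((∫ t in (0 : ℝ)..u, legCurvature κ σ β t : ℝ) : ℂ) * Complex.I))
          = ∫ u in (0 : ℝ)..(2 * m),
            Complex.exp (((∫ t in (0 : ℝ)..u, c t : ℝ) : ℂ) * Complex.I) := by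
        refine integral_congr fun t ht => ?_
        rw [Set.uIcc_of_le (by positivity)] at ht
        simp only [hI t ht.1 ht.2]
      have h2 : (∫ u in (0 : ℝ)..m, Real.cos ((∫ t in (0 : ℝ)..u, c t) - ∫ t in (0 : ℝ)..m, c t))
          = turnRadius κ σ * Real.sin (β / 2 + turnGamma κ σ) := by
        rw [← hint]
        refine integral_congr fun t ht => ?_
        rw [Set.uIcc_of_le hm0] at ht
        simp only [hΘ t ht.1 ht.2, hmm]
      rw [h1, turn_symm' hc m hsym (fun u => ∫ t in (0 : ℝ)..u, c t) (fun _ => rfl), h2, hmm]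
      push_cast
      ring
  have hX := turnRadius_sin hκ hσ hθ
  have hY := innerRadius_eq hκ hσ hθ
  rcases h0.eq_or_lt with rfl | hβ
  · refine ⟨fun _ => 0, continuous_const, fun _ => rfl, fun u hu hu' => ?_, fun _ => 0, ?_, ?_, ?_⟩
    · have : turnSharpness κ σ 0 = 0 := by simp [turnSharpness]
      simp [legCurvature, not_lt.2 hu', hth, this]
    · simp
    · simp
    · simp [turnLength]
      ring
  by_cases hb : β < thetaLim κ σ
  · have hs := turnSharpness_pos hκ hσ hθ hβ hb
    set s := turnSharpness κ σ β with hsdef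
    have hlen : turnLength κ σ β = 2 * Real.sqrt (β / s) := by
      simp [turnLength, hβ.ne', hb, hsdef]
    set a := Real.sqrt (β / s) with ha
    have hm : turnLength κ σ β / 2 = a := by rw [hlen]; ring
    have ha2 : s * a ^ 2 = β := by
      rw [ha, Real.sq_sqrt (by positivity)]; field_simp
    have ha0 : 0 ≤ a := Real.sqrt_nonneg _
    refine ⟨fun u => s * min u (turnLength κ σ β - u), by fun_prop, fun u => ?_,
      fun u hu hu' => ?_, fun u => s * u ^ 2 / 2, fun u hu hu' => ?_, ?_, ?_⟩
    · simp only [sub_sub_cancel]; rw [min_comm]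
    · simp only [legCurvature, not_lt.2 hu', hb, if_true, if_false]
      split_ifs with h
      · rw [min_eq_left (by linarith)]
      · rw [min_eq_right (by linarith)]
    · rw [show (∫ t in (0 : ℝ)..u, s * min t (turnLength κ σ β - t)) = ∫ t in (0 : ℝ)..u, s * t from ?_]
      · rw [intervalIntegral.integral_const_mul, integral_id]; ring
      · refine integral_congr fun t ht => ?_
        rw [Set.uIcc_of_le hu] at ht
        rw [min_eq_left (by linarith [ht.2])]
    · simp only [hm, ha2]
    · rw [hm]
      have h1 := integral_comp_mul_left (a := 0) (b := 1) (c := a)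
        (fun u => Real.cos (s * u ^ 2 / 2 - β / 2))
      have h2 := mul_integral_comp_mul_left (a := 0) (b := 1) (c := a)
        (f := fun u => Real.cos (s * u ^ 2 / 2 - β / 2))
      simp only [mul_zero, mul_one] at h2
      rw [← h2]
      have h3 : (∫ v in (0 : ℝ)..1, Real.cos (s * (a * v) ^ 2 / 2 - β / 2)) = chordRatio β := by
        refine integral_congr fun v _ => ?_
        rw [← Real.cos_neg (β / 2 * (1 - v ^ 2))]
        congr 1
        rw [mul_pow, ← ha2]; ring
      rw [h3]
      have hD := chordRatio_pos hβ (hb.trans hθ)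
      have hS := sin_turn_pos hκ hσ hθ hβ (hb.trans hθ)
      have hR := turnRadius_pos hκ hσ hθ
      have : β / s = (turnRadius κ σ * Real.sin (β / 2 + turnGamma κ σ) / chordRatio β) ^ 2 := by
        rw [hsdef, turnSharpness]; field_simp
      rw [ha, this, Real.sqrt_sq (by positivity)]
      field_simp
  · have hb' : thetaLim κ σ ≤ β := not_lt.1 hb
    have hlen : turnLength κ σ β = β / κ + κ / σ := by simp [turnLength, hβ.ne', hb]
    have hL0 : 0 < κ / σ := by positivity
    have hL : κ * (κ / σ) = thetaLim κ σ := by unfold thetaLim; ring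
    have hL2 : σ * (κ / σ) = κ := by field_simp
    have hβκ : κ * (β / κ) = β := by field_simp
    set L := κ / σ with hLdef
    have hLβ : L ≤ β / κ := by rw [le_div_iff₀ hκ]; linarith
    rw [hlen]
    set m := (β / κ + L) / 2 with hmdef
    have hLm : L ≤ m := by rw [hmdef]; linarith
    have hc : Continuous fun u : ℝ => min (min (σ * u) κ) (σ * (β / κ + L - u)) := by fun_prop
    have hΘ1 : ∀ u, 0 ≤ u → u ≤ L →
        (∫ t in (0 : ℝ)..u, min (min (σ * t) κ) (σ * (β / κ + L - t))) = σ * u ^ 2 / 2 := by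
      intro u hu hu'
      rw [show (∫ t in (0 : ℝ)..u, min (min (σ * t) κ) (σ * (β / κ + L - t)))
        = ∫ t in (0 : ℝ)..u, σ * t from ?_]
      · rw [intervalIntegral.integral_const_mul, integral_id]; ring
      · refine integral_congr fun t ht => ?_
        rw [Set.uIcc_of_le hu] at ht
        have h1 : σ * t ≤ κ := by nlinarith [ht.2]
        have h2 : σ * t ≤ σ * (β / κ + L - t) := by nlinarith [ht.2]
        rw [min_eq_left h1, min_eq_left h2]
    have hΘ2 : ∀ u, L ≤ u → u ≤ m →
        (∫ t in (0 : ℝ)..u, min (min (σ * t) κ) (σ * (β / κ + L - t)))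
          = thetaLim κ σ / 2 + κ * (u - L) := by
      intro u hu hu'
      rw [← integral_add_adjacent_intervals (hc.intervalIntegrable (μ := volume) 0 L)
        (hc.intervalIntegrable L u), hΘ1 L hL0.le le_rfl,
        show (∫ t in L..u, min (min (σ * t) κ) (σ * (β / κ + L - t))) = ∫ t in L..u, κ from ?_]
      · simp
        rw [← hL]
        linear_combination (L / 2) * hL2
      · refine integral_congr fun t ht => ?_
        rw [Set.uIcc_of_le hu] at ht
        have h1 : κ ≤ σ * t := by nlinarith [ht.1]
        have h2 : κ ≤ σ * (β / κ + L - t) := by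
          have : L ≤ β / κ + L - t := by linarith [ht.2]
          nlinarith
        rw [min_eq_right h1, min_eq_left h2]
    refine ⟨_, hc, fun u => ?_, fun u hu hu' => ?_, fun u => ∫ t in (0 : ℝ)..u,
      min (min (σ * t) κ) (σ * (β / κ + L - t)), fun _ _ _ => rfl, ?_, ?_⟩
    · simp only [sub_sub_cancel]
      rw [min_comm, min_comm _ κ, min_left_comm, min_assoc, min_left_comm]
    · simp only [legCurvature, hlen, not_lt.2 hu', hb, if_false, add_sub_cancel_right, ← hLdef]
      split_ifs with h1 h2
      · have i1 : σ * u ≤ κ := by nlinarith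
        have i2 : σ * u ≤ σ * (β / κ + L - u) := by nlinarith
        rw [min_eq_left i1, min_eq_left i2]
      · have i1 : κ ≤ σ * u := by nlinarith
        have i2 : κ ≤ σ * (β / κ + L - u) := by nlinarith
        rw [min_eq_right i1, min_eq_left i2]
      · have i1 : κ ≤ σ * u := by nlinarith
        have i2 : σ * (β / κ + L - u) ≤ κ := by nlinarith
        rw [min_eq_right i1, min_eq_right i2]
    · refine (hΘ2 m hLm le_rfl).trans ?_
      rw [← hL, hmdef]
      linear_combination hβκ / 2
    · have hcont := continuous_primitive (fun a b => hc.intervalIntegrable (μ := volume) a b) 0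
      have hcc : Continuous fun u : ℝ => Real.cos ((∫ t in (0 : ℝ)..u,
          min (min (σ * t) κ) (σ * (β / κ + L - t))) - β / 2) := by fun_prop
      rw [← integral_add_adjacent_intervals (hcc.intervalIntegrable (μ := volume) 0 L)
        (hcc.intervalIntegrable L m)]
      have e1 : (∫ u in (0 : ℝ)..L, Real.cos ((∫ t in (0 : ℝ)..u,
          min (min (σ * t) κ) (σ * (β / κ + L - t))) - β / 2))
          = Real.cos (β / 2) * (∫ u in (0 : ℝ)..L, Real.cos (σ * u ^ 2 / 2))
            + Real.sin (β / 2) * ∫ u in (0 : ℝ)..L, Real.sin (σ * u ^ 2 / 2) := by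
        rw [← intervalIntegral.integral_const_mul, ← intervalIntegral.integral_const_mul,
          ← integral_add
            ((by fun_prop : Continuous fun u : ℝ =>
              Real.cos (β / 2) * Real.cos (σ * u ^ 2 / 2)).intervalIntegrable _ _)
            ((by fun_prop : Continuous fun u : ℝ =>
              Real.sin (β / 2) * Real.sin (σ * u ^ 2 / 2)).intervalIntegrable _ _)]
        refine integral_congr fun u hu => ?_
        rw [Set.uIcc_of_le hL0.le] at hu
        simp only [hΘ1 u hu.1 hu.2, Real.cos_sub]
        ring
      have e2 : (∫ u in L..m, Real.cos ((∫ t in (0 : ℝ)..u,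
          min (min (σ * t) κ) (σ * (β / κ + L - t))) - β / 2))
          = Real.sin (β / 2 - thetaLim κ σ / 2) / κ := by
        rw [show (∫ u in L..m, Real.cos ((∫ t in (0 : ℝ)..u,
          min (min (σ * t) κ) (σ * (β / κ + L - t))) - β / 2))
          = ∫ u in L..m, Real.cos (κ * u + (thetaLim κ σ / 2 - κ * L - β / 2)) from ?_]
        · rw [intervalIntegral.integral_comp_mul_add _ hκ.ne', integral_cos,
            show κ * m + (thetaLim κ σ / 2 - κ * L - β / 2) = 0 from ?_,
            show κ * L + (thetaLim κ σ / 2 - κ * L - β / 2)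
              = -(β / 2 - thetaLim κ σ / 2) by ring, Real.sin_neg]
          · simp; ring
          · rw [← hL, hmdef]
            linear_combination hβκ / 2
        · refine integral_congr fun u hu => ?_
          rw [Set.uIcc_of_le hLm] at hu
          simp only [hΘ2 u hu.1 hu.2]
          congr 1; ring
      rw [e1, e2, Real.sin_sub, Real.sin_add, mul_add]
      have hX' : turnRadius κ σ * (Real.cos (β / 2) * Real.sin (turnGamma κ σ))
        = Real.cos (β / 2) * centerX κ σ := by rw [← hX]; ring
      have hY' : turnRadius κ σ * (Real.sin (β / 2) * Real.cos (turnGamma κ σ))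
        = Real.sin (β / 2) * centerY κ σ := by rw [← hY, innerRadius]; ring
      rw [hX', hY', centerX, centerY, ← hLdef]
      ring

/-- The curve `legPath` with the prescribed curvature profile leads to the goal: it gets there
at arclength `legLength`, with orientation `legEndHeading`. -/
theorem leg_end (hκ : 0 < κ) (hσ : 0 < σ) (hθ : thetaLim κ σ < Real.pi) (p : ℂ) (θ : ℝ) (g : ℂ)
    (hg : 2 * turnRadius κ σ < ‖g - p‖) :
    legHeading κ σ p θ g (legLength κ σ p θ g) = legEndHeading κ σ p θ g ∧
      legPath κ σ p θ g (legLength κ σ p θ g) = g := by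
  have hX := turnRadius_sin hκ hσ hθ
  have hY := innerRadius_eq hκ hσ hθ
  have hX0 := centerX_nonneg hκ hσ hθ
  have hY0 := centerY_pos hκ hσ hθ
  have hR := turnRadius_pos hκ hσ hθ
  have hRsq : turnRadius κ σ ^ 2 = centerX κ σ ^ 2 + centerY κ σ ^ 2 :=
    Real.sq_sqrt (by positivity)
  set d := relGoal p θ g with hd
  set v := centerToGoal κ σ p θ g with hv
  set α := Real.arcsin (innerRadius κ σ / ‖v‖) with hα
  set β := legTurn κ σ p θ g with hβ
  have hβ0 : 0 ≤ β := (toIcoMod_mem_Ico Real.two_pi_pos 0 _).1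
  obtain ⟨hturn1, hturn2⟩ := turn_end hκ hσ hθ hβ0
  have hlcc := turnLength_nonneg hκ hσ hθ hβ0
  have hdn : ‖d‖ = ‖g - p‖ := by
    rw [hd, relGoal, norm_mul, ← neg_mul, ← Complex.ofReal_neg, Complex.norm_exp_ofReal_mul_I,
      mul_one]
  have hvn : turnRadius κ σ < ‖v‖ := by
    have h1 : ‖(⟨d.re, |d.im|⟩ : ℂ)‖ = ‖d‖ := by
      simp [Complex.norm_def, Complex.normSq_apply]
    have h2 : ‖(⟨centerX κ σ, centerY κ σ⟩ : ℂ)‖ = turnRadius κ σ := by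
      rw [turnRadius, Complex.norm_def, Complex.normSq_apply]
      congr 1; ring
    have h3 : (⟨d.re, |d.im|⟩ : ℂ) = v + ⟨centerX κ σ, centerY κ σ⟩ := by
      apply Complex.ext <;> simp [hv, centerToGoal, hd]
    have h4 := norm_add_le v ⟨centerX κ σ, centerY κ σ⟩
    rw [← h3, h1, h2, hdn] at h4
    linarith
  have hv0 : 0 < ‖v‖ := hR.trans hvn
  set ls := Real.sqrt (‖v‖ ^ 2 - innerRadius κ σ ^ 2) with hls
  have hsq : turnRadius κ σ ^ 2 ≤ ‖v‖ ^ 2 := pow_le_pow_left₀ hR.le hvn.le 2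
  have hlsX : centerX κ σ ≤ ls := by
    rw [hls, hY]
    exact Real.le_sqrt_of_sq_le (by nlinarith)
  have hsinα : ‖v‖ * Real.sin α = innerRadius κ σ := by
    have hY1 : innerRadius κ σ ≤ ‖v‖ := by
      rw [hY]; nlinarith [sq_nonneg (centerX κ σ)]
    rw [hα, Real.sin_arcsin, mul_div_cancel₀ _ hv0.ne']
    · have : 0 ≤ innerRadius κ σ / ‖v‖ := by rw [hY]; positivity
      linarith
    · exact (div_le_one hv0).2 hY1
  have hcosα : ‖v‖ * Real.cos α = ls := by
    rw [hls, ← hsinα, show ‖v‖ ^ 2 - (‖v‖ * Real.sin α) ^ 2 = (‖v‖ * Real.cos α) ^ 2 by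
      rw [mul_pow, mul_pow, Real.cos_sq']; ring]
    refine (Real.sqrt_sq (mul_nonneg hv0.le ?_)).symm
    rw [hα]; exact Real.cos_arcsin_nonneg _
  have hexp : Complex.exp (β * Complex.I)
      = Complex.exp (Complex.arg v * Complex.I) * Complex.exp (α * Complex.I) := by
    have h1 : β = Complex.arg v + α
        - (toIcoDiv Real.two_pi_pos 0 (Complex.arg v + α)) • (2 * Real.pi) := rfl
    rw [← Complex.exp_add, h1]
    refine Complex.exp_eq_exp_iff_exists_int.2
      ⟨-toIcoDiv Real.two_pi_pos 0 (Complex.arg v + α), ?_⟩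
    push_cast [zsmul_eq_mul]
    ring
  have hvβ : v = Complex.exp (β * Complex.I) * (ls - innerRadius κ σ * Complex.I) := by
    have h1 : (ls : ℂ) - innerRadius κ σ * Complex.I
        = ‖v‖ * Complex.exp (-(α * Complex.I)) := by
      rw [← hcosα, ← hsinα, ← neg_mul, Complex.exp_mul_I, Complex.cos_neg, Complex.sin_neg]
      push_cast; ring
    rw [h1, hexp]
    have h2 := Complex.norm_mul_exp_arg_mul_I v
    have h3 : Complex.exp (α * Complex.I) * Complex.exp (-(α * Complex.I)) = 1 := by
      rw [← Complex.exp_add]; simp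
    calc v = ‖v‖ * Complex.exp (Complex.arg v * Complex.I) := h2.symm
      _ = ‖v‖ * Complex.exp (Complex.arg v * Complex.I)
          * (Complex.exp (α * Complex.I) * Complex.exp (-(α * Complex.I))) := by rw [h3, mul_one]
      _ = _ := by ring
  have hlen : legLength κ σ p θ g = turnLength κ σ β + (ls - centerX κ σ) := by
    rw [legLength, hX]; ring
  set lcc := turnLength κ σ β with hlccdef
  set lf := legLength κ σ p θ g with hlf
  have hle : lcc ≤ lf := by linarith
  -- the orientation after the turn
  have hzero : ∀ u, lcc < u → legCurvature κ σ β u = 0 := fun u hu => by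
    simp [legCurvature, ← hlccdef, hu]
  have hint : IntervalIntegrable (legCurvature κ σ β) volume 0 lcc := by
    by_cases hb : β = 0
    · have h0 : legCurvature κ σ β = fun _ => 0 := by
        have h1 : turnSharpness κ σ β = 0 := by simp [turnSharpness, hb]
        have h2 : β < thetaLim κ σ := by rw [hb]; unfold thetaLim; positivity
        funext u
        simp [legCurvature, h1, h2]
      rw [h0]
      exact intervalIntegrable_const
    · by_contra h
      rw [integral_undef h] at hturn1
      exact hb hturn1.symm
  have hafter : ∀ u, lcc ≤ u → (∫ t in (0 : ℝ)..u, legCurvature κ σ β t) = β := by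
    intro u hu
    have h0 : ∀ᵐ t ∂volume, t ∈ Set.uIoc lcc u → legCurvature κ σ β t = 0 := by
      refine Filter.Eventually.of_forall fun t ht => ?_
      rw [Set.uIoc_of_le hu] at ht
      exact hzero t ht.1
    have h1 : IntervalIntegrable (legCurvature κ σ β) volume lcc u := by
      refine (intervalIntegrable_const (c := (0 : ℝ))).congr ?_
      intro t ht
      rw [Set.uIoc_of_le hu] at ht
      exact (hzero t ht.1).symm
    rw [← integral_add_adjacent_intervals hint h1, hturn1, integral_zero_ae h0, add_zero]
  have hexpint : (∫ u in (0 : ℝ)..lf,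
      Complex.exp (((∫ t in (0 : ℝ)..u, legCurvature κ σ β t : ℝ) : ℂ) * Complex.I))
      = ⟨d.re, |d.im|⟩ := by
    have h1 : IntervalIntegrable (fun u => Complex.exp
        (((∫ t in (0 : ℝ)..u, legCurvature κ σ β t : ℝ) : ℂ) * Complex.I)) volume 0 lcc := by
      refine ContinuousOn.intervalIntegrable ?_
      have := continuousOn_primitive_interval (μ := volume) (f := legCurvature κ σ β)
        (a := 0) (b := lcc) ((intervalIntegrable_iff').1 hint)
      fun_prop
    have hc : ∀ u ∈ Set.uIcc lcc lf, Complex.exp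
        (((∫ t in (0 : ℝ)..u, legCurvature κ σ β t : ℝ) : ℂ) * Complex.I)
        = Complex.exp (β * Complex.I) := by
      intro u hu
      rw [Set.uIcc_of_le hle] at hu
      rw [hafter u hu.1]
    have h2 : IntervalIntegrable (fun u => Complex.exp
        (((∫ t in (0 : ℝ)..u, legCurvature κ σ β t : ℝ) : ℂ) * Complex.I)) volume lcc lf := by
      refine (intervalIntegrable_const (c := Complex.exp (β * Complex.I))).congr ?_
      intro t ht
      exact (hc t (Set.uIoc_subset_uIcc ht)).symm
    rw [← integral_add_adjacent_intervals h1 h2, hturn2, integral_congr hc,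
      intervalIntegral.integral_const, hlen]
    have h3 : (⟨d.re, |d.im|⟩ : ℂ) = v + (centerX κ σ + centerY κ σ * Complex.I) := by
      apply Complex.ext <;> simp [hv, centerToGoal, hd]
    have h4 : Complex.exp (β * Complex.I)
        = Complex.exp ((β / 2 : ℝ) * Complex.I) * Complex.exp ((β / 2 : ℝ) * Complex.I) := by
      rw [← Complex.exp_add]; congr 1; push_cast; ring
    have h5 : 2 * turnRadius κ σ * Real.sin (β / 2 + turnGamma κ σ)
        = 2 * (Real.sin (β / 2) * centerY κ σ + Real.cos (β / 2) * centerX κ σ) := by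
      rw [Real.sin_add, ← hX, ← hY, innerRadius]; ring
    have h6 := Real.sin_sq_add_cos_sq (β / 2)
    have h6' : (Real.sin (β / 2) : ℂ) ^ 2 + (Real.cos (β / 2) : ℂ) ^ 2 = 1 := by exact_mod_cast h6
    rw [h3, hvβ, h4, h5, hY, Complex.exp_mul_I, ← Complex.ofReal_cos, ← Complex.ofReal_sin,
      Complex.real_smul]
    push_cast
    push_cast at h6'
    have hI := Complex.I_sq
    generalize Complex.sin ((β : ℂ) / 2) = S at *
    generalize Complex.cos ((β : ℂ) / 2) = C at *
    generalize (centerX κ σ : ℂ) = X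
    generalize (centerY κ σ : ℂ) = Y
    linear_combination (X + Y * Complex.I) * h6' + (2 * S * C * Y - X * S ^ 2 + Y * Complex.I * S ^ 2) * hI
  have hkey : (∫ u in (0 : ℝ)..lf, Complex.exp ((turnSide p θ g *
      (∫ t in (0 : ℝ)..u, legCurvature κ σ β t) : ℝ) * Complex.I)) = d := by
    unfold turnSide
    rw [← hd]
    split_ifs with h
    · simp only [one_mul]
      rw [hexpint, abs_of_nonneg h]
    · have h1 : (∫ u in (0 : ℝ)..lf, Complex.exp (((-1 : ℝ) *
          (∫ t in (0 : ℝ)..u, legCurvature κ σ β t) : ℝ) * Complex.I))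
          = ∫ u in (0 : ℝ)..lf, (starRingEnd ℂ) (Complex.exp
            (((∫ t in (0 : ℝ)..u, legCurvature κ σ β t : ℝ) : ℂ) * Complex.I)) := by
        refine integral_congr fun u _ => ?_
        simp [← Complex.exp_conj]
      have h0 : 0 ≤ lf := hlcc.trans hle
      rw [h1, integral_of_le h0, integral_conj, ← integral_of_le h0, hexpint,
        abs_of_neg (not_le.1 h)]
      apply Complex.ext <;> simp
  constructor
  · rw [legHeading, legEndHeading, ← hβ, hafter lf hle]
  · have h1 : (∫ u in (0 : ℝ)..lf, Complex.exp (legHeading κ σ p θ g u * Complex.I))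
        = Complex.exp (θ * Complex.I) * d := by
      rw [← hkey, ← intervalIntegral.integral_const_mul]
      refine integral_congr fun u _ => ?_
      simp only [legHeading, ← hβ]
      rw [← Complex.exp_add]
      congr 1
      push_cast
      ring
    rw [legPath, h1, hd, relGoal]
    have h2 : Complex.exp (θ * Complex.I) * Complex.exp (-(θ * Complex.I)) = 1 := by
      rw [← Complex.exp_add]; simp
    linear_combination (g - p) * h2

end Lemmas

section Ratio

variable (κ σ : ℝ)

/-- The largest turn `β_max(l)` that a leg to a goal at distance `l` needs. -/
def betaMax (l : ℝ) : ℝ :=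
  Real.pi + 2 * Real.arctan (innerRadius κ σ / (l + turnRadius κ σ * Real.sin (turnGamma κ σ)))

/-- The bound `R_max` on the ratio between the arclength of a leg and the distance of its ends,
where `l` is the minimal distance `l_min`. -/
def ratioMax (l : ℝ) : ℝ :=
  Real.sqrt ((l + turnRadius κ σ) ^ 2 - innerRadius κ σ ^ 2) / l
    + (max (betaMax κ σ l / κ + κ / σ) (4.66 * turnRadius κ σ / l) + turnRadius κ σ) / l

end Ratio

/-- The data: `nip` interest points, `nt` thermals, `ng` gliders. -/
structure Scenario (nip nt ng : ℕ) where
  /-- positions of the interest points -/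
  interestPos : Fin nip → ℂ
  /-- positions of the thermals -/
  thermalPos : Fin nt → ℂ
  /-- height gained at the thermals -/
  thermalHeight : Fin nt → ℝ
  /-- start positions of the gliders -/
  startPos : Fin ng → ℂ
  /-- start orientations of the gliders -/
  startHeading : Fin ng → ℝ
  /-- start heights of the gliders -/
  startHeight : Fin ng → ℝ
  /-- final positions of the gliders -/
  finalPos : Fin ng → ℂ
  /-- the angle of descent -/
  descent : ℝ
  /-- maximal curvature -/
  kmax : ℝ
  /-- maximal sharpness -/
  smax : ℝ
  thermalHeight_pos : ∀ k, 0 < thermalHeight k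
  startHeading_mem : ∀ i, startHeading i ∈ Set.Icc (-Real.pi) Real.pi
  startHeight_pos : ∀ i, 0 < startHeight i
  descent_mem : descent ∈ Set.Ioo 0 (Real.pi / 2)
  kmax_pos : 0 < kmax
  smax_pos : 0 < smax

/-- Entries of a visitation order: interest points, thermals, and the final position `f`. -/
inductive Waypoint (nip nt : ℕ) where
  | interest (j : Fin nip) : Waypoint nip nt
  | thermal (k : Fin nt) : Waypoint nip nt
  | final : Waypoint nip nt
  deriving DecidableEq

namespace Scenario

variable {nip nt ng : ℕ} (P : Scenario nip nt ng)

/-- All interest points, thermals, start positions and final positions. -/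
def point : Fin nip ⊕ Fin nt ⊕ Fin ng ⊕ Fin ng → ℂ :=
  Sum.elim P.interestPos (Sum.elim P.thermalPos (Sum.elim P.startPos P.finalPos))

/-- The smallest distance `l_min` between any two of these points. -/
def minDist : ℝ :=
  ⨅ q : {q : (Fin nip ⊕ Fin nt ⊕ Fin ng ⊕ Fin ng) × (Fin nip ⊕ Fin nt ⊕ Fin ng ⊕ Fin ng) //
    q.1 ≠ q.2}, dist (P.point q.1.1) (P.point q.1.2)

/-- The constant `R_max` of the scenario. -/
def rmax : ℝ := ratioMax P.kmax P.smax P.minDist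

/-! ### Visitation orders of a glider -/

section SingleAgent

variable (i : Fin ng)

/-- The position of a waypoint of glider `i`. -/
def pos : Waypoint nip nt → ℂ
  | .interest j => P.interestPos j
  | .thermal k => P.thermalPos k
  | .final => P.finalPos i

/-- The total arclength of the composite path that starts at `p` with orientation `θ`
and visits the given waypoints in turn; each leg starts where the previous one ended,
with the orientation that it ended with. -/
def pathLength : ℂ → ℝ → List (Waypoint nip nt) → ℝ
  | _, _, [] => 0
  | p, θ, w :: ws =>
    legLength P.kmax P.smax p θ (P.pos i w)
      + pathLength (P.pos i w) (legEndHeading P.kmax P.smax p θ (P.pos i w)) ws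

/-- The arclength `S_L` of a visitation order. -/
def arclength (lam : List (Waypoint nip nt)) : ℝ :=
  P.pathLength i (P.startPos i) (P.startHeading i) lam

/-- The upper bound `S_L^max` on the arclength of a visitation order. -/
def arclengthMax (lam : List (Waypoint nip nt)) : ℝ :=
  (P.startHeight i + ∑ k : Fin nt, if Waypoint.thermal k ∈ lam then P.thermalHeight k else 0)
    / Real.tan P.descent

/-- The number `K_L` of unvisited allocated interest points. -/
def unvisited (lam : List (Waypoint nip nt)) (ξ : Finset (Fin nip)) : ℝ :=
  (ξ.card : ℝ) - ∑ j : Fin nip, if Waypoint.interest j ∈ lam then (1 : ℝ) else 0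

/-- The waypoints that may be visited under the allocation `ξ`. -/
def Allowed (ξ : Finset (Fin nip)) : Waypoint nip nt → Prop
  | .interest j => j ∈ ξ
  | .thermal _ => True
  | .final => True

/-- Goal nodes: the last waypoint is the final position. -/
def IsGoal (lam : List (Waypoint nip nt)) : Prop := lam.getLast? = some .final

/-- `lam'` is a child of `lam` in the lower level graph `Γ_L(ξ)`. -/
def IsChild (ξ : Finset (Fin nip)) (lam lam' : List (Waypoint nip nt)) : Prop :=
  ¬ IsGoal lam ∧ ∃ μ, Allowed ξ μ ∧ μ ∉ lam ∧ lam' = lam ++ [μ]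

/-- Nodes of `Γ_L(ξ)` which satisfy `S < S_L^max` together with all their ancestors, the
root excepted, where `S` is some measure of arclength. -/
inductive Admissible (S : List (Waypoint nip nt) → ℝ) (ξ : Finset (Fin nip)) :
    List (Waypoint nip nt) → Prop
  | root : Admissible S ξ []
  | child {lam lam' : List (Waypoint nip nt)} (h : Admissible S ξ lam) (hc : IsChild ξ lam lam')
      (hS : S lam' < P.arclengthMax i lam') : Admissible S ξ lam'

/-- Valid nodes. -/
def Valid (ξ : Finset (Fin nip)) (lam : List (Waypoint nip nt)) : Prop :=
  P.Admissible i (fun l => P.arclength i l) ξ lam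

/-- Weakly valid nodes. -/
def WeaklyValid (ξ : Finset (Fin nip)) (lam : List (Waypoint nip nt)) : Prop :=
  P.Admissible i (fun l => P.arclength i l / P.rmax) ξ lam

/-- The penalty `P_L`. -/
def penaltyL : ℝ :=
  (P.startHeight i + (∑ k : Fin nt, P.thermalHeight k) + 1) / Real.tan P.descent

open Classical in
/-- The cost `V_L` of a node. -/
def costL (ξ : Finset (Fin nip)) (lam : List (Waypoint nip nt)) : ℝ :=
  if IsGoal lam then P.arclength i lam + unvisited lam ξ * P.penaltyL i else P.arclength i lam

open Classical in
/-- The weak cost of a node. -/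
def weakCostL (ξ : Finset (Fin nip)) (lam : List (Waypoint nip nt)) : ℝ :=
  if IsGoal lam then P.arclength i lam / P.rmax + unvisited lam ξ * P.penaltyL i
  else P.arclength i lam / P.rmax

/-- `lam` is an optimal visitation order for the allocation `ξ` to glider `i`: it has the least cost
among the valid goal nodes. -/
def IsOptimal (ξ : Finset (Fin nip)) (lam : List (Waypoint nip nt)) : Prop :=
  (IsGoal lam ∧ P.Valid i ξ lam) ∧
    ∀ μ, IsGoal μ ∧ P.Valid i ξ μ → P.costL i ξ lam ≤ P.costL i ξ μ

/-- `lam` is weakly optimal: it has the least weak cost among the weakly valid goal nodes. -/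
def IsWeaklyOptimal (ξ : Finset (Fin nip)) (lam : List (Waypoint nip nt)) : Prop :=
  (IsGoal lam ∧ P.WeaklyValid i ξ lam) ∧
    ∀ μ, IsGoal μ ∧ P.WeaklyValid i ξ μ → P.weakCostL i ξ lam ≤ P.weakCostL i ξ μ

end SingleAgent

/-! ### Sets of allocations -/

/-- The penalty `P_U`. -/
def penaltyU : ℝ :=
  ((∑ i : Fin ng, P.startHeight i) + (∑ k : Fin nt, P.thermalHeight k) + 1) / Real.tan P.descent

/-- `c` is the cost `S_U(Ξ) + P_U K_U(Ξ)` of `Ξ`, computed from optimal visitation orders. -/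
def HasCost (Ξ : Fin ng → Finset (Fin nip)) (c : ℝ) : Prop :=
  ∃ lam : Fin ng → List (Waypoint nip nt), (∀ i, P.IsOptimal i (Ξ i) (lam i)) ∧
    c = (∑ i, P.arclength i (lam i)) + P.penaltyU * ∑ i, unvisited (lam i) (Ξ i)

/-- `w` is the weak cost of `Ξ`, computed from weakly optimal visitation orders. -/
def HasWeakCost (Ξ : Fin ng → Finset (Fin nip)) (w : ℝ) : Prop :=
  ∃ lam : Fin ng → List (Waypoint nip nt), (∀ i, P.IsWeaklyOptimal i (Ξ i) (lam i)) ∧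
    w = ∑ i, P.weakCostL i (Ξ i) (lam i)

end Scenario

/-- `Ξ'` is a child of `Ξ` in the upper level graph `Γ_U`: one unallocated interest point is
allocated to one of the gliders. -/
def AllocChild {nip ng : ℕ} (Ξ Ξ' : Fin ng → Finset (Fin nip)) : Prop :=
  ∃ l ζ, (∀ i, ζ ∉ Ξ i) ∧ Ξ' = Function.update Ξ l (insert ζ (Ξ l))

/-- The nodes of `Γ_U`: the root, in which nothing is allocated, and its descendants. -/
def IsAllocNode {nip ng : ℕ} (Ξ : Fin ng → Finset (Fin nip)) : Prop :=
  Relation.ReflTransGen AllocChild (fun _ => ∅) Ξ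

/-- `Ξ''` is a descendant (child, child of child, …) of `Ξ'` in `Γ_U`. -/
def IsDescendant {nip ng : ℕ} (Ξ' Ξ'' : Fin ng → Finset (Fin nip)) : Prop :=
  Relation.TransGen AllocChild Ξ' Ξ''

end

end Soaring

namespace Soaring

open MeasureTheory intervalIntegral

/-! ### Arclength of CC turns. -/

section LegBounds

variable {κ σ : ℝ}

/-! From each glider's optimal order for the larger allocation, delete the interest points that the
smaller allocation lacks. What remains is a weakly valid goal node whose weak cost is at most that
glider's share of the cost of `Ξ''`. Weak optimality and summation over the gliders then give the
inequality. Since there are only finitely many nodes, the existence of one weakly valid goal node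
also yields a weakly optimal one.

CC paths do not obey a triangle inequality under deletion, because later orientations change.
Polygonal paths do, and a leg between points at distance `d ≥ l_min` has length between `d` and
`R_max * d`. Hence S(short) / R_max ≤ polygon(short) ≤ polygon(long) ≤ S(long), which is
`arclength_div_le_of_sublist`. Deletion keeps every thermal, so `S_L^max` is unchanged; the number
of unvisited points does not grow; and `P_L ≤ P_U`.

The lower bound on a leg holds because it is a unit speed curve that ends at the goal (`leg_end`).
For the upper bound (`legLength_le`), the leg is split into the tangent length and the remainder
`l^cc - x_Ω`. The tangent length divided by `d` is bounded by a decreasing function of `d`, whose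
value at `l_min` is the first summand of `R_max`. The remainder is at most `π/κ + κ/σ + R_T` for
turns by at most `π + 1` (`turnLength_sub_le`), and a goal farther away than `2 R_T` never needs a
larger turn (`legTurn_le`). Of `β_max` only the inequality `β_max ≥ π` is needed. -/

lemma thetaLim_pos (hκ : 0 < κ) (hσ : 0 < σ) : 0 < thetaLim κ σ := by
  unfold thetaLim; positivity

lemma turnRadius_sq : turnRadius κ σ ^ 2 = centerX κ σ ^ 2 + centerY κ σ ^ 2 :=
  Real.sq_sqrt (by positivity)

lemma centerX_le_turnRadius : centerX κ σ ≤ turnRadius κ σ :=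
  Real.le_sqrt_of_sq_le (by nlinarith [sq_nonneg (centerY κ σ)])

lemma centerY_le_turnRadius : centerY κ σ ≤ turnRadius κ σ :=
  Real.le_sqrt_of_sq_le (by nlinarith [sq_nonneg (centerX κ σ)])

/-- The turning circle is at least as large as the circle of maximal curvature. -/
lemma inv_le_centerY (hκ : 0 < κ) (hσ : 0 < σ) (hθ : thetaLim κ σ < Real.pi) :
    1 / κ ≤ centerY κ σ := by
  have h2 : σ * (κ / σ) ^ 2 = thetaLim κ σ := by unfold thetaLim; field_simp
  -- The weight `σ u / κ` makes the integrand an exact derivative. It is at most 1 on the interval,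
  -- and the sine is nonnegative there, so dropping the weight only increases the integral.
  have hs : ∫ u in (0 : ℝ)..(κ / σ), (σ * u / κ) * Real.sin (σ * u ^ 2 / 2)
      = 1 / κ - Real.cos (thetaLim κ σ / 2) / κ := by
    rw [integral_eq_sub_of_hasDerivAt (f := fun u => -Real.cos (σ * u ^ 2 / 2) / κ)]
    · simp [h2]
      ring
    · intro u _
      have h : HasDerivAt (fun u : ℝ => σ * u ^ 2 / 2) (σ * u) u := by
        refine (((hasDerivAt_pow 2 u).const_mul σ).div_const 2).congr_deriv ?_
        norm_num
        ring
      exact (h.cos.neg.div_const κ).congr_deriv (by ring)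
    · exact (by fun_prop : Continuous fun u : ℝ =>
        (σ * u / κ) * Real.sin (σ * u ^ 2 / 2)).intervalIntegrable _ _
  have hmono : ∫ u in (0 : ℝ)..(κ / σ), (σ * u / κ) * Real.sin (σ * u ^ 2 / 2)
      ≤ ∫ u in (0 : ℝ)..(κ / σ), Real.sin (σ * u ^ 2 / 2) := by
    refine integral_mono_on (by positivity)
      ((by fun_prop : Continuous fun u : ℝ =>
        (σ * u / κ) * Real.sin (σ * u ^ 2 / 2)).intervalIntegrable _ _)
      ((by fun_prop : Continuous fun u : ℝ => Real.sin (σ * u ^ 2 / 2)).intervalIntegrable _ _)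
      fun u hu => ?_
    have h1 : u ^ 2 ≤ (κ / σ) ^ 2 := pow_le_pow_left₀ hu.1 hu.2 2
    have h3 : 0 ≤ σ * u ^ 2 / 2 := by have := hu.1; positivity
    have hc : 0 ≤ Real.sin (σ * u ^ 2 / 2) :=
      Real.sin_nonneg_of_nonneg_of_le_pi h3 (by nlinarith [Real.pi_pos])
    have hu1 : σ * u / κ ≤ 1 := by
      rw [div_le_one hκ]
      have := (le_div_iff₀ hσ).1 hu.2
      linarith
    nlinarith
  unfold centerY
  linarith

/-- A symmetric turn by `2 * a` made of two clothoids of length `1`, in terms of Fresnel integrals. -/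
lemma chordRatio_eq (a : ℝ) :
    chordRatio (2 * a) = Real.cos a * (∫ s in (0 : ℝ)..1, Real.cos (a * s ^ 2))
      + Real.sin a * ∫ s in (0 : ℝ)..1, Real.sin (a * s ^ 2) := by
  rw [chordRatio, ← intervalIntegral.integral_const_mul, ← intervalIntegral.integral_const_mul,
    ← integral_add
      ((by fun_prop : Continuous fun s : ℝ =>
        Real.cos a * Real.cos (a * s ^ 2)).intervalIntegrable _ _)
      ((by fun_prop : Continuous fun s : ℝ =>
        Real.sin a * Real.sin (a * s ^ 2)).intervalIntegrable _ _)]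
  refine integral_congr fun s _ => ?_
  rw [← Real.cos_sub]
  congr 1; ring

/-- The angle `b * (1 - s ^ 2)` never exceeds `b`. This bound absorbs the horizontal part `x_Ω
cos(β/2)` of a short turn. -/
lemma cos_le_chordRatio {b : ℝ} (h0 : 0 ≤ b) (h1 : b ≤ Real.pi) :
    Real.cos b ≤ chordRatio (2 * b) := by
  have h : ∫ _ in (0 : ℝ)..1, Real.cos b = Real.cos b := by simp
  rw [← h, chordRatio]
  refine integral_mono_on zero_le_one intervalIntegrable_const
    ((by fun_prop : Continuous fun s : ℝ =>
      Real.cos (2 * b / 2 * (1 - s ^ 2))).intervalIntegrable _ _) fun s hs => ?_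
  have h2 : 0 ≤ 1 - s ^ 2 := by nlinarith [hs.1, hs.2]
  have h3 : 1 - s ^ 2 ≤ 1 := by nlinarith [sq_nonneg s]
  exact Real.cos_le_cos_of_nonneg_of_le_pi (by positivity) h1 (by nlinarith)

lemma chordRatio_anti {a b : ℝ} (h0 : 0 ≤ b) (hab : b ≤ a) (h1 : a ≤ Real.pi) :
    chordRatio (2 * a) ≤ chordRatio (2 * b) := by
  unfold chordRatio
  refine integral_mono_on zero_le_one
    ((by fun_prop : Continuous fun s : ℝ =>
      Real.cos (2 * a / 2 * (1 - s ^ 2))).intervalIntegrable _ _)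
    ((by fun_prop : Continuous fun s : ℝ =>
      Real.cos (2 * b / 2 * (1 - s ^ 2))).intervalIntegrable _ _) fun s hs => ?_
  have h2 : 0 ≤ 1 - s ^ 2 := by nlinarith [hs.1, hs.2]
  have h3 : 1 - s ^ 2 ≤ 1 := by nlinarith [sq_nonneg s]
  exact Real.cos_le_cos_of_nonneg_of_le_pi (by positivity) (by nlinarith) (by nlinarith)

/-- The chord bound `1 - 2x/π ≤ cos x`, taken at `x = π s² / 2`, reads `1 - s²`, and this has
integral 2/3. The constant is good enough because `π * (2/3) > 2`. -/
lemma two_thirds_le_integral_cos {a : ℝ} (h0 : 0 ≤ a) (h1 : a ≤ Real.pi / 2) :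
    2 / 3 ≤ ∫ s in (0 : ℝ)..1, Real.cos (a * s ^ 2) := by
  have h : ∫ s in (0 : ℝ)..1, (1 - s ^ 2) = (2 / 3 : ℝ) := by
    rw [integral_sub intervalIntegrable_const
      ((by fun_prop : Continuous fun s : ℝ => s ^ 2).intervalIntegrable _ _), integral_pow]
    norm_num
  rw [← h]
  refine integral_mono_on zero_le_one
    ((by fun_prop : Continuous fun s : ℝ => 1 - s ^ 2).intervalIntegrable _ _)
    ((by fun_prop : Continuous fun s : ℝ => Real.cos (a * s ^ 2)).intervalIntegrable _ _)
    fun s hs => ?_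
  have h3 : s ^ 2 ≤ 1 := by nlinarith [hs.1, hs.2]
  have h4 := Real.one_sub_mul_le_cos (x := Real.pi / 2 * s ^ 2) (by positivity)
    (by nlinarith [Real.pi_pos])
  have h5 : Real.cos (Real.pi / 2 * s ^ 2) ≤ Real.cos (a * s ^ 2) :=
    Real.cos_le_cos_of_nonneg_of_le_pi (by positivity) (by nlinarith [Real.pi_pos]) (by gcongr)
  have h6 : 2 / Real.pi * (Real.pi / 2 * s ^ 2) = s ^ 2 := by
    field_simp [Real.pi_pos.ne']
  linarith

/-- Substituting `u = (κ/σ) s` expresses `y_Ω` by the same Fresnel integral that occurs in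
`chordRatio` at the limit deflection. -/
lemma centerY_eq (hκ : 0 < κ) (hσ : 0 < σ) :
    centerY κ σ = κ / σ * (∫ s in (0 : ℝ)..1, Real.sin (thetaLim κ σ / 2 * s ^ 2))
      + Real.cos (thetaLim κ σ / 2) / κ := by
  have h2 := mul_integral_comp_mul_left (a := 0) (b := 1) (c := κ / σ)
    (f := fun u => Real.sin (σ * u ^ 2 / 2))
  simp only [mul_zero, mul_one] at h2
  rw [centerY, ← h2]
  congr 2
  refine integral_congr fun s _ => ?_
  simp only [thetaLim]
  congr 1
  field_simp

/-- The vertical part of a turn of limit deflection. -/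
lemma centerY_mul_sin_le (hκ : 0 < κ) (hσ : 0 < σ) (hθ : thetaLim κ σ < Real.pi) :
    2 * centerY κ σ * Real.sin (thetaLim κ σ / 2)
      ≤ (Real.pi / κ + κ / σ) * chordRatio (thetaLim κ σ) := by
  have h0 := thetaLim_pos hκ hσ
  have hD := chordRatio_eq (thetaLim κ σ / 2)
  rw [show 2 * (thetaLim κ σ / 2) = thetaLim κ σ by ring] at hD
  rw [hD, centerY_eq hκ hσ]
  have hC := two_thirds_le_integral_cos (a := thetaLim κ σ / 2) (by linarith) (by linarith)
  have hS : 0 ≤ ∫ s in (0 : ℝ)..1, Real.sin (thetaLim κ σ / 2 * s ^ 2) := by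
    refine integral_nonneg zero_le_one fun s hs => ?_
    have h3 : s ^ 2 ≤ 1 := by nlinarith [hs.1, hs.2]
    exact Real.sin_nonneg_of_nonneg_of_le_pi (by positivity) (by nlinarith)
  have hL : κ / σ = thetaLim κ σ / κ := by unfold thetaLim; field_simp
  have hsin : 0 ≤ Real.sin (thetaLim κ σ / 2) :=
    Real.sin_nonneg_of_nonneg_of_le_pi (by linarith) (by linarith)
  have hsin1 := Real.sin_le_one (thetaLim κ σ / 2)
  have hcos : 0 ≤ Real.cos (thetaLim κ σ / 2) :=
    Real.cos_nonneg_of_mem_Icc ⟨by linarith, by linarith⟩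
  rw [hL]
  generalize (∫ s in (0 : ℝ)..1, Real.cos (thetaLim κ σ / 2 * s ^ 2)) = C at *
  generalize (∫ s in (0 : ℝ)..1, Real.sin (thetaLim κ σ / 2 * s ^ 2)) = S at *
  generalize Real.sin (thetaLim κ σ / 2) = s at *
  generalize Real.cos (thetaLim κ σ / 2) = c at *
  generalize thetaLim κ σ = t at *
  have e : 2 * (t / κ * S + c / κ) * s = (2 * t * (S * s) + 2 * (c * s)) / κ := by ring
  have e' : (Real.pi / κ + t / κ) * (c * C + s * S)
      = ((Real.pi + t) * (S * s) + (Real.pi + t) * C * c) / κ := by ring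
  rw [e, e']
  -- The terms with `c` and those with `S * s` are compared separately: the former use `C ≥ 2/3` and
  -- `s ≤ 1`, the latter `t < π`.
  have h3 : 2 ≤ (Real.pi + t) * C := by nlinarith [Real.pi_gt_three]
  have h4 : 2 * (c * s) ≤ (Real.pi + t) * C * c := by nlinarith
  have h5 : 2 * t * (S * s) ≤ (Real.pi + t) * (S * s) := by
    have : 0 ≤ S * s := by positivity
    nlinarith
  gcongr

/-- The length is `2 (x_Ω cos(β/2) + y_Ω sin(β/2)) / chordRatio β`. The horizontal part contributes
at most `2 x_Ω`, one half of which is subtracted and the other bounded by `R_T`; the vertical part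
contributes at most `π/κ + κ/σ`. -/
lemma turnLength_sub_le_of_lt (hκ : 0 < κ) (hσ : 0 < σ) (hθ : thetaLim κ σ < Real.pi) {β : ℝ}
    (h0 : 0 < β) (h1 : β < thetaLim κ σ) :
    turnLength κ σ β - centerX κ σ ≤ Real.pi / κ + κ / σ + turnRadius κ σ := by
  have hX := turnRadius_sin hκ hσ hθ
  have hY := innerRadius_eq hκ hσ hθ
  have hX0 := centerX_nonneg hκ hσ hθ
  have hY0 := centerY_pos hκ hσ hθ
  have hR := turnRadius_pos hκ hσ hθ
  have hXR := centerX_le_turnRadius (κ := κ) (σ := σ)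
  have hD := chordRatio_pos h0 (h1.trans hθ)
  have hDl := chordRatio_pos (thetaLim_pos hκ hσ) hθ
  have hS := sin_turn_pos hκ hσ hθ h0 (h1.trans hθ)
  have hlen : turnLength κ σ β
      = 2 * (turnRadius κ σ * Real.sin (β / 2 + turnGamma κ σ) / chordRatio β) := by
    have : β / turnSharpness κ σ β
        = (turnRadius κ σ * Real.sin (β / 2 + turnGamma κ σ) / chordRatio β) ^ 2 := by
      rw [turnSharpness]; field_simp
    rw [turnLength, if_neg h0.ne', if_pos h1, this, Real.sqrt_sq (by positivity)]
  have hexp : turnRadius κ σ * Real.sin (β / 2 + turnGamma κ σ)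
      = centerX κ σ * Real.cos (β / 2) + centerY κ σ * Real.sin (β / 2) := by
    rw [Real.sin_add, ← hX, ← hY, innerRadius]; ring
  have hcos := cos_le_chordRatio (b := β / 2) (by linarith) (by linarith)
  have hanti := chordRatio_anti (b := β / 2) (a := thetaLim κ σ / 2) (by linarith) (by linarith)
    (by linarith)
  rw [show 2 * (β / 2) = β by ring] at hcos hanti
  rw [show 2 * (thetaLim κ σ / 2) = thetaLim κ σ by ring] at hanti
  have hlast := centerY_mul_sin_le hκ hσ hθ
  have hsin : Real.sin (β / 2) ≤ Real.sin (thetaLim κ σ / 2) :=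
    Real.sin_le_sin_of_le_of_le_pi_div_two (by linarith) (by linarith) (by linarith)
  have hsum : 0 ≤ Real.pi / κ + κ / σ := by have := Real.pi_pos; positivity
  -- As `β` grows, `sin(β/2)` increases and `chordRatio β` decreases, so the limit deflection is the
  -- worst case.
  have e1 : 2 * centerY κ σ * Real.sin (β / 2) ≤ (Real.pi / κ + κ / σ) * chordRatio β :=
    calc _ ≤ 2 * centerY κ σ * Real.sin (thetaLim κ σ / 2) := by gcongr
      _ ≤ (Real.pi / κ + κ / σ) * chordRatio (thetaLim κ σ) := hlast
      _ ≤ _ := by gcongr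
  have e2 : centerX κ σ * Real.cos (β / 2) ≤ centerX κ σ * chordRatio β := by gcongr
  have e3 : turnLength κ σ β ≤ 2 * centerX κ σ + (Real.pi / κ + κ / σ) := by
    rw [hlen, hexp, ← mul_div_assoc, div_le_iff₀ hD]
    linarith
  linarith

/-- A bound for the arclength of turns by at most `π + 1`. -/
lemma turnLength_sub_le (hκ : 0 < κ) (hσ : 0 < σ) (hθ : thetaLim κ σ < Real.pi) {β : ℝ}
    (h0 : 0 ≤ β) (h1 : β ≤ Real.pi + 1) :
    turnLength κ σ β - centerX κ σ ≤ Real.pi / κ + κ / σ + turnRadius κ σ := by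
  have hX0 := centerX_nonneg hκ hσ hθ
  have hXR := centerX_le_turnRadius (κ := κ) (σ := σ)
  have hpi := Real.pi_pos
  have hsum : 0 ≤ Real.pi / κ + κ / σ := by positivity
  rcases h0.eq_or_lt with rfl | hβ
  · rw [turnLength, if_pos rfl, mul_assoc, turnRadius_sin hκ hσ hθ]
    linarith
  by_cases hb : β < thetaLim κ σ
  · exact turnLength_sub_le_of_lt hκ hσ hθ hβ hb
  · have h2 : β / κ ≤ (Real.pi + 1) / κ := by gcongr
    -- The excess of the turn over `π` costs at most `1/κ ≤ y_Ω ≤ R_T`.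
    have h3 := inv_le_centerY hκ hσ hθ
    have h4 := centerY_le_turnRadius (κ := κ) (σ := σ)
    rw [add_div] at h2
    rw [turnLength, if_neg hβ.ne', if_neg hb]
    linarith

/-! ### The length of a leg compared with the distance of its ends. -/

section Goal

variable (p : ℂ) (θ : ℝ) (g : ℂ)

lemma norm_relGoal : ‖relGoal p θ g‖ = ‖g - p‖ := by
  rw [relGoal, norm_mul, ← neg_mul, ← Complex.ofReal_neg, Complex.norm_exp_ofReal_mul_I, mul_one]

lemma norm_center : ‖(⟨centerX κ σ, centerY κ σ⟩ : ℂ)‖ = turnRadius κ σ := by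
  rw [turnRadius, Complex.norm_def, Complex.normSq_apply]
  congr 1; ring

lemma norm_reflected : ‖(⟨(relGoal p θ g).re, |(relGoal p θ g).im|⟩ : ℂ)‖ = ‖g - p‖ := by
  rw [← norm_relGoal p θ g]
  simp [Complex.norm_def, Complex.normSq_apply]

lemma centerToGoal_add : centerToGoal κ σ p θ g + ⟨centerX κ σ, centerY κ σ⟩
    = ⟨(relGoal p θ g).re, |(relGoal p θ g).im|⟩ := by
  apply Complex.ext <;> simp [centerToGoal]

lemma norm_centerToGoal_le : ‖centerToGoal κ σ p θ g‖ ≤ ‖g - p‖ + turnRadius κ σ := by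
  have h := norm_sub_le (⟨(relGoal p θ g).re, |(relGoal p θ g).im|⟩ : ℂ)
    ⟨centerX κ σ, centerY κ σ⟩
  rwa [norm_reflected, norm_center, ← centerToGoal_add, add_sub_cancel_right] at h

lemma le_norm_centerToGoal : ‖g - p‖ - turnRadius κ σ ≤ ‖centerToGoal κ σ p θ g‖ := by
  have h := norm_add_le (centerToGoal κ σ p θ g) ⟨centerX κ σ, centerY κ σ⟩
  rw [centerToGoal_add, norm_reflected, norm_center] at h
  linarith

variable {p θ g}

/-- The last segment of a leg lies on the tangent to the inner circle that is traversed in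
direction `β`. -/
lemma centerToGoal_eq (hκ : 0 < κ) (hσ : 0 < σ) (hθ : thetaLim κ σ < Real.pi)
    (hg : 2 * turnRadius κ σ < ‖g - p‖) :
    centerToGoal κ σ p θ g = Complex.exp (legTurn κ σ p θ g * Complex.I)
      * (Real.sqrt (‖centerToGoal κ σ p θ g‖ ^ 2 - innerRadius κ σ ^ 2)
        - innerRadius κ σ * Complex.I) := by
  have hY := innerRadius_eq hκ hσ hθ
  have hY0 := centerY_pos hκ hσ hθ
  have hYR := centerY_le_turnRadius (κ := κ) (σ := σ)
  have hR := turnRadius_pos hκ hσ hθ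
  have hle := le_norm_centerToGoal (κ := κ) (σ := σ) p θ g
  set v := centerToGoal κ σ p θ g with hv
  set α := Real.arcsin (innerRadius κ σ / ‖v‖) with hα
  set β := legTurn κ σ p θ g with hβ
  set ls := Real.sqrt (‖v‖ ^ 2 - innerRadius κ σ ^ 2) with hls
  have hv0 : 0 < ‖v‖ := by linarith
  have hsinα : ‖v‖ * Real.sin α = innerRadius κ σ := by
    rw [hα, Real.sin_arcsin, mul_div_cancel₀ _ hv0.ne']
    · have : 0 ≤ innerRadius κ σ / ‖v‖ := by rw [hY]; positivity
      linarith
    · exact (div_le_one hv0).2 (by linarith)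
  have hcosα : ‖v‖ * Real.cos α = ls := by
    rw [hls, ← hsinα, show ‖v‖ ^ 2 - (‖v‖ * Real.sin α) ^ 2 = (‖v‖ * Real.cos α) ^ 2 by
      rw [mul_pow, mul_pow, Real.cos_sq']; ring]
    refine (Real.sqrt_sq (mul_nonneg hv0.le ?_)).symm
    rw [hα]; exact Real.cos_arcsin_nonneg _
  have hexp : Complex.exp (β * Complex.I)
      = Complex.exp (Complex.arg v * Complex.I) * Complex.exp (α * Complex.I) := by
    have h1 : β = Complex.arg v + α
        - (toIcoDiv Real.two_pi_pos 0 (Complex.arg v + α)) • (2 * Real.pi) := rfl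
    rw [← Complex.exp_add, h1]
    refine Complex.exp_eq_exp_iff_exists_int.2
      ⟨-toIcoDiv Real.two_pi_pos 0 (Complex.arg v + α), ?_⟩
    push_cast [zsmul_eq_mul]
    ring
  have h1 : (ls : ℂ) - innerRadius κ σ * Complex.I = ‖v‖ * Complex.exp (-(α * Complex.I)) := by
    rw [← hcosα, ← hsinα, ← neg_mul, Complex.exp_mul_I, Complex.cos_neg, Complex.sin_neg]
    push_cast; ring
  rw [h1, hexp]
  have h2 := Complex.norm_mul_exp_arg_mul_I v
  have h3 : Complex.exp (α * Complex.I) * Complex.exp (-(α * Complex.I)) = 1 := by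
    rw [← Complex.exp_add]; simp
  linear_combination (-1 : ℂ) * h2
    - (‖v‖ * Complex.exp (Complex.arg v * Complex.I)) * h3

/-- A line that passes at distance `Y` from the centre `(X, Y)` with direction `π + φ`, `φ ≥ 1`,
leaves the upper half plane close to the origin. -/
lemma tangent_bound {X Y l c s : ℝ} (hX : 0 ≤ X) (hY : 0 < Y) (hl : 0 ≤ l) (hs : 0 < s)
    (hcs : s ^ 2 + c ^ 2 = 1) (hc : c ≤ 3 / 5) (him : 0 ≤ Y + (Y * c - l * s)) :
    (X - (l * c + Y * s)) ^ 2 + (Y + (Y * c - l * s)) ^ 2 ≤ X ^ 2 + 4 * Y ^ 2 := by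
  have hc1 : -1 < c := by nlinarith
  -- With `A = l c + Y s ≥ 0`, the term `-2 X A` in the expanded square can be dropped. For `c < 0`,
  -- the hypothesis `l s ≤ Y (1 + c)` gives `A s ≥ Y (1 + c)`.
  have hA : 0 ≤ l * c + Y * s := by
    rcases le_or_gt 0 c with h | h
    · positivity
    · have h1 : 0 ≤ (l * c + Y * s) * s := by nlinarith
      exact nonneg_of_mul_nonneg_left h1 hs
  have hXA : 0 ≤ X * (l * c + Y * s) := by positivity
  have hz : 0 ≤ l * s := by positivity
  have h1 : l ^ 2 * (1 - c) ≤ l * s * Y := by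
    have h2 : 0 ≤ (1 + c) * (l * s * Y - l ^ 2 * (1 - c)) := by
      have e : (1 + c) * (l * s * Y - l ^ 2 * (1 - c)) = l * s * (Y + (Y * c - l * s)) := by
        linear_combination l ^ 2 * hcs
      rw [e]; positivity
    have := nonneg_of_mul_nonneg_right h2 (by linarith)
    linarith
  -- Since `A² + (Y c - l s)² = l² + Y²`, this is what remains of the claim without the term in `X`.
  have h3 : l ^ 2 ≤ 4 * Y ^ 2 - 2 * Y ^ 2 * (1 + c) + 2 * Y * (l * s) := by
    have h4 : l * s ≤ (1 - c) * (2 * Y * (1 - c) + 2 * (l * s)) := by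
      rcases le_or_gt c (1 / 2) with h | h
      · nlinarith [mul_nonneg hY.le (sq_nonneg (1 - c)), mul_nonneg hz (by linarith : 0 ≤ 1 / 2 - c)]
      -- For `c > 1/2` the worst case is `l s = Y (1 + c)`, where the inequality becomes `(1 + c)(2c
      -- - 1) ≤ 2 (1 - c)²`, that is `c ≤ 3/5`.
      · nlinarith [mul_le_mul_of_nonneg_right (by linarith : l * s ≤ Y * (1 + c))
          (by linarith : 0 ≤ 2 * c - 1)]
    have h5 : (1 - c) * l ^ 2 ≤ (1 - c) * (4 * Y ^ 2 - 2 * Y ^ 2 * (1 + c) + 2 * Y * (l * s)) := by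
      nlinarith
    exact le_of_mul_le_mul_left h5 (by linarith)
  nlinarith

/-- No leg to a goal at distance more than `2 * R_T` turns by more than `π + 1`. -/
lemma legTurn_le (hκ : 0 < κ) (hσ : 0 < σ) (hθ : thetaLim κ σ < Real.pi)
    (hg : 2 * turnRadius κ σ < ‖g - p‖) : legTurn κ σ p θ g ≤ Real.pi + 1 := by
  have hX0 := centerX_nonneg hκ hσ hθ
  have hY0 := centerY_pos hκ hσ hθ
  have hR := turnRadius_pos hκ hσ hθ
  have hRsq := turnRadius_sq (κ := κ) (σ := σ)
  have hv := centerToGoal_eq (θ := θ) hκ hσ hθ hg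
  have hβ := (toIcoMod_mem_Ico Real.two_pi_pos 0 (Complex.arg (centerToGoal κ σ p θ g)
      + Real.arcsin (innerRadius κ σ / ‖centerToGoal κ σ p θ g‖))).2
  change legTurn κ σ p θ g < 0 + 2 * Real.pi at hβ
  rw [innerRadius_eq hκ hσ hθ] at hv
  have hd := norm_reflected p θ g
  rw [← centerToGoal_add (κ := κ) (σ := σ)] at hd
  have him : 0 ≤ (centerToGoal κ σ p θ g + ⟨centerX κ σ, centerY κ σ⟩ : ℂ).im := by
    rw [centerToGoal_add]; exact abs_nonneg _
  have hl := Real.sqrt_nonneg (‖centerToGoal κ σ p θ g‖ ^ 2 - centerY κ σ ^ 2)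
  generalize Real.sqrt (‖centerToGoal κ σ p θ g‖ ^ 2 - centerY κ σ ^ 2) = l at *
  generalize centerToGoal κ σ p θ g = v at *
  generalize legTurn κ σ p θ g = β at *
  by_contra! h
  -- Now `1 < φ < π`, so the sine is positive and `cos φ ≤ cos 1 < 3/5`.
  obtain ⟨φ, rfl⟩ : ∃ φ, β = φ + Real.pi := ⟨β - Real.pi, by ring⟩
  have hre' : v.re = -(l * Real.cos φ + centerY κ σ * Real.sin φ) := by
    rw [hv, Complex.exp_mul_I, ← Complex.ofReal_cos, ← Complex.ofReal_sin, Real.cos_add_pi,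
      Real.sin_add_pi]
    simp [-Complex.ofReal_cos, -Complex.ofReal_sin]
    ring
  have him' : v.im = centerY κ σ * Real.cos φ - l * Real.sin φ := by
    rw [hv, Complex.exp_mul_I, ← Complex.ofReal_cos, ← Complex.ofReal_sin, Real.cos_add_pi,
      Real.sin_add_pi]
    simp [-Complex.ofReal_cos, -Complex.ofReal_sin]
    ring
  have hs : 0 < Real.sin φ := Real.sin_pos_of_pos_of_lt_pi (by linarith) (by linarith)
  have hc : Real.cos φ ≤ 3 / 5 := by
    have := Real.cos_le_cos_of_nonneg_of_le_pi (x := 1) (y := φ) (by norm_num) (by linarith)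
      (by linarith)
    linarith [Real.cos_one_le]
  simp only [Complex.add_im, him'] at him
  have hb := tangent_bound hX0 hY0 hl hs (Real.sin_sq_add_cos_sq φ) hc (by linarith)
  have hsq : ‖g - p‖ ^ 2 = (centerX κ σ - (l * Real.cos φ + centerY κ σ * Real.sin φ)) ^ 2
      + (centerY κ σ + (centerY κ σ * Real.cos φ - l * Real.sin φ)) ^ 2 := by
    rw [← hd, Complex.sq_norm, Complex.normSq_apply]
    simp only [Complex.add_re, Complex.add_im, hre', him']
    ring
  -- The bound `x_Ω² + 4 y_Ω² ≤ 4 R_T²` contradicts the distance of the goal.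
  nlinarith

/-- The centre is farther than `R_T` from the goal, and `R_T² - R_M² = x_Ω²`. Hence the segment
after the turn has nonnegative length. -/
lemma centerX_le_sqrt (hκ : 0 < κ) (hσ : 0 < σ) (hθ : thetaLim κ σ < Real.pi)
    (hg : 2 * turnRadius κ σ < ‖g - p‖) :
    centerX κ σ ≤ Real.sqrt (‖centerToGoal κ σ p θ g‖ ^ 2 - innerRadius κ σ ^ 2) := by
  have hR := turnRadius_pos hκ hσ hθ
  have hRsq := turnRadius_sq (κ := κ) (σ := σ)
  have hle := le_norm_centerToGoal (κ := κ) (σ := σ) p θ g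
  rw [innerRadius_eq hκ hσ hθ]
  exact Real.le_sqrt_of_sq_le (by nlinarith)

lemma legTurn_nonneg : 0 ≤ legTurn κ σ p θ g := (toIcoMod_mem_Ico Real.two_pi_pos 0 _).1

/-- A leg is at least as long as the distance between its ends. -/
lemma dist_le_legLength (hκ : 0 < κ) (hσ : 0 < σ) (hθ : thetaLim κ σ < Real.pi)
    (hg : 2 * turnRadius κ σ < ‖g - p‖) : ‖g - p‖ ≤ legLength κ σ p θ g := by
  have h0 : 0 ≤ legLength κ σ p θ g := by
    have := centerX_le_sqrt (θ := θ) hκ hσ hθ hg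
    have := turnLength_nonneg hκ hσ hθ (legTurn_nonneg (κ := κ) (σ := σ) (p := p) (θ := θ) (g := g))
    rw [legLength, turnRadius_sin hκ hσ hθ]
    linarith
  have h1 := (leg_end hκ hσ hθ p θ g hg).2
  rw [legPath] at h1
  -- The displacement is an integral of unit vectors over an interval of length `legLength`.
  have h2 : g - p = ∫ u in (0 : ℝ)..(legLength κ σ p θ g),
      Complex.exp (legHeading κ σ p θ g u * Complex.I) := by linear_combination -h1
  rw [h2]
  have h3 := norm_integral_le_of_norm_le_const (a := 0) (b := legLength κ σ p θ g) (C := 1)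
    (f := fun u => Complex.exp (legHeading κ σ p θ g u * Complex.I))
    fun u _ => (Complex.norm_exp_ofReal_mul_I _).le
  rwa [sub_zero, abs_of_nonneg h0, one_mul] at h3

lemma pi_le_betaMax (hκ : 0 < κ) (hσ : 0 < σ) (hθ : thetaLim κ σ < Real.pi) {l : ℝ} (hl : 0 < l) :
    Real.pi ≤ betaMax κ σ l := by
  have hX0 := centerX_nonneg hκ hσ hθ
  have hY0 := centerY_pos hκ hσ hθ
  rw [betaMax, turnRadius_sin hκ hσ hθ, innerRadius_eq hκ hσ hθ]
  have : 0 ≤ Real.arctan (centerY κ σ / (l + centerX κ σ)) := Real.arctan_nonneg.2 (by positivity)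
  linarith

/-- `β_max` exceeds `π` by a nonnegative arctangent, so the first entry of the maximum suffices. -/
lemma turn_le_max (hκ : 0 < κ) (hσ : 0 < σ) (hθ : thetaLim κ σ < Real.pi) {l : ℝ} (hl : 0 < l) :
    Real.pi / κ + κ / σ
      ≤ max (betaMax κ σ l / κ + κ / σ) (4.66 * turnRadius κ σ / l) := by
  refine le_max_of_le_left ?_
  have := pi_le_betaMax hκ hσ hθ hl
  gcongr

lemma ratioMax_pos (hκ : 0 < κ) (hσ : 0 < σ) (hθ : thetaLim κ σ < Real.pi) {l : ℝ} (hl : 0 < l) :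
    0 < ratioMax κ σ l := by
  have h := turn_le_max hκ hσ hθ hl
  have hR := turnRadius_pos hκ hσ hθ
  have hpi : 0 < Real.pi / κ + κ / σ := by have := Real.pi_pos; positivity
  have hm := hpi.trans_le h
  unfold ratioMax
  positivity

/-- A leg is at most `R_max` times as long as the distance between its ends. -/
lemma legLength_le (hκ : 0 < κ) (hσ : 0 < σ) (hθ : thetaLim κ σ < Real.pi) {l : ℝ}
    (hl : 2 * turnRadius κ σ < l) (hg : l ≤ ‖g - p‖) :
    legLength κ σ p θ g ≤ ratioMax κ σ l * ‖g - p‖ := by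
  have hR := turnRadius_pos hκ hσ hθ
  have hRsq := turnRadius_sq (κ := κ) (σ := σ)
  have hY := innerRadius_eq hκ hσ hθ
  have hl0 : 0 < l := by linarith
  have hturn := turnLength_sub_le hκ hσ hθ legTurn_nonneg
    (legTurn_le (θ := θ) hκ hσ hθ (hl.trans_le hg))
  have hmax := turn_le_max hκ hσ hθ hl0
  have hv := norm_centerToGoal_le (κ := κ) (σ := σ) p θ g
  rw [legLength, turnRadius_sin hκ hσ hθ, ratioMax, add_mul]
  generalize max (betaMax κ σ l / κ + κ / σ) (4.66 * turnRadius κ σ / l) = M at *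
  have hM : 0 ≤ M := by
    have := Real.pi_pos
    exact (by positivity : 0 ≤ Real.pi / κ + κ / σ).trans hmax
  set d := ‖g - p‖
  have hd0 : 0 < d := hl0.trans_le hg
  -- The quotient `√((d + R_T)² - R_M²) / d` decreases in `d`. After clearing denominators and
  -- squaring, the difference of the sides is `2 R_T l d (d - l) + (R_T² - R_M²)(d² - l²)`.
  have h1 : Real.sqrt (‖centerToGoal κ σ p θ g‖ ^ 2 - innerRadius κ σ ^ 2)
      ≤ Real.sqrt ((l + turnRadius κ σ) ^ 2 - innerRadius κ σ ^ 2) / l * d := by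
    rw [div_mul_eq_mul_div, le_div_iff₀ hl0]
    have hY1 : innerRadius κ σ ^ 2 ≤ turnRadius κ σ ^ 2 := by
      rw [hY, hRsq]; nlinarith [sq_nonneg (centerX κ σ)]
    have hvsq : ‖centerToGoal κ σ p θ g‖ ^ 2 ≤ (d + turnRadius κ σ) ^ 2 := by gcongr
    have hmul : ∀ a x : ℝ, 0 < x → Real.sqrt a * x = Real.sqrt (a * x ^ 2) := fun a x hx => by
      rw [Real.sqrt_mul' _ (sq_nonneg x), Real.sqrt_sq hx.le]
    rw [hmul _ l hl0, hmul _ d hd0]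
    refine Real.sqrt_le_sqrt ?_
    have h2 : (‖centerToGoal κ σ p θ g‖ ^ 2 - innerRadius κ σ ^ 2) * l ^ 2
        ≤ ((d + turnRadius κ σ) ^ 2 - innerRadius κ σ ^ 2) * l ^ 2 := by gcongr
    have h3 : l ^ 2 ≤ d ^ 2 := by gcongr
    have h4 : 0 ≤ turnRadius κ σ * (l * d * (d - l)) :=
      mul_nonneg hR.le (mul_nonneg (by positivity) (by linarith))
    nlinarith [mul_nonneg (sub_nonneg.2 hY1) (sub_nonneg.2 h3)]
  have h2 : M + turnRadius κ σ ≤ (M + turnRadius κ σ) / l * d := by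
    rw [div_mul_eq_mul_div, le_div_iff₀ hl0]
    gcongr
  linarith

end Goal

end LegBounds

end Soaring

namespace Soaring

/-! ### Restriction of visitation orders to a smaller allocation. -/

section Orders

variable {nip nt ng : ℕ}

namespace Waypoint

/-- Waypoints as elements of a sum type. -/
def toSum : Waypoint nip nt → Fin nip ⊕ Fin nt ⊕ Unit
  | .interest j => Sum.inl j
  | .thermal k => Sum.inr (Sum.inl k)
  | .final => Sum.inr (Sum.inr ())

lemma toSum_injective : Function.Injective (toSum (nip := nip) (nt := nt)) := by
  rintro (j | k | _) (j' | k' | _) h <;> simp_all [toSum]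

instance : Finite (Waypoint nip nt) := Finite.of_injective _ toSum_injective

end Waypoint

open Classical in
/-- The part of a visitation order that the allocation `ξ` allows. -/
noncomputable def restrict (ξ : Finset (Fin nip)) (lam : List (Waypoint nip nt)) :
    List (Waypoint nip nt) :=
  lam.filter fun w => decide (Scenario.Allowed ξ w)

lemma mem_restrict {ξ : Finset (Fin nip)} {lam : List (Waypoint nip nt)} {w : Waypoint nip nt} :
    w ∈ restrict ξ lam ↔ w ∈ lam ∧ Scenario.Allowed ξ w := by
  simp [restrict]

lemma restrict_sublist (ξ : Finset (Fin nip)) (lam : List (Waypoint nip nt)) :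
    (restrict ξ lam).Sublist lam := List.filter_sublist

lemma restrict_append_of_allowed {ξ : Finset (Fin nip)} (lam : List (Waypoint nip nt))
    {w : Waypoint nip nt} (h : Scenario.Allowed ξ w) :
    restrict ξ (lam ++ [w]) = restrict ξ lam ++ [w] := by
  simp [restrict, h]

lemma restrict_append_of_not_allowed {ξ : Finset (Fin nip)} (lam : List (Waypoint nip nt))
    {w : Waypoint nip nt} (h : ¬ Scenario.Allowed ξ w) :
    restrict ξ (lam ++ [w]) = restrict ξ lam := by
  simp [restrict, h]

lemma isGoal_restrict (ξ : Finset (Fin nip)) {lam : List (Waypoint nip nt)}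
    (h : Scenario.IsGoal lam) : Scenario.IsGoal (restrict ξ lam) := by
  obtain ⟨l, rfl⟩ := List.getLast?_eq_some_iff.1 h
  rw [restrict_append_of_allowed _ (show Scenario.Allowed ξ Waypoint.final from trivial)]
  exact List.getLast?_concat

/-! ### Distances between waypoints, polygonal paths and composite paths. -/

namespace Scenario

variable (P : Scenario nip nt ng) (i : Fin ng)

lemma minDist_le {q q' : Fin nip ⊕ Fin nt ⊕ Fin ng ⊕ Fin ng} (h : q ≠ q') :
    P.minDist ≤ dist (P.point q) (P.point q') :=
  ciInf_le (f := fun q : {q : (Fin nip ⊕ Fin nt ⊕ Fin ng ⊕ Fin ng) ×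
      (Fin nip ⊕ Fin nt ⊕ Fin ng ⊕ Fin ng) // q.1 ≠ q.2} => dist (P.point q.1.1) (P.point q.1.2))
    -- A real infimum is a lower bound only for families bounded below; here 0 is a bound.
    ⟨0, by rintro _ ⟨_, rfl⟩; exact dist_nonneg⟩ ⟨(q, q'), h⟩

/-- The index of the position of a waypoint among all points. -/
def index : Waypoint nip nt → Fin nip ⊕ Fin nt ⊕ Fin ng ⊕ Fin ng
  | .interest j => Sum.inl j
  | .thermal k => Sum.inr (Sum.inl k)
  | .final => Sum.inr (Sum.inr (Sum.inr i))

lemma point_index (w : Waypoint nip nt) : P.point (index i w) = P.pos i w := by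
  cases w <;> rfl

lemma index_injective : Function.Injective (index (nip := nip) (nt := nt) i) := by
  rintro (j | k | _) (j' | k' | _) h <;> simp_all [index]

lemma minDist_le_pos {w w' : Waypoint nip nt} (h : w ≠ w') :
    P.minDist ≤ dist (P.pos i w) (P.pos i w') := by
  rw [← point_index, ← point_index]
  exact P.minDist_le fun e => h (index_injective i e)

lemma minDist_le_start (w : Waypoint nip nt) : P.minDist ≤ dist (P.startPos i) (P.pos i w) := by
  rw [← point_index, show P.startPos i = P.point (Sum.inr (Sum.inr (Sum.inl i))) from rfl]
  refine P.minDist_le ?_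
  cases w <;> simp [index]

/-- The length of the polygonal path from `p` through the given waypoints. -/
noncomputable def polyLength : ℂ → List (Waypoint nip nt) → ℝ
  | _, [] => 0
  | p, w :: ws => dist p (P.pos i w) + polyLength (P.pos i w) ws

lemma polyLength_le_dist_add (p q : ℂ) (ws : List (Waypoint nip nt)) :
    P.polyLength i p ws ≤ dist p q + P.polyLength i q ws := by
  cases ws with
  | nil => simp [polyLength]
  | cons w ws =>
    simp only [polyLength]
    linarith [dist_triangle p q (P.pos i w)]

/-- Skipping waypoints shortens a polygonal path. -/
lemma polyLength_le_of_sublist {ws ws' : List (Waypoint nip nt)} (h : ws.Sublist ws') (p : ℂ) :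
    P.polyLength i p ws ≤ P.polyLength i p ws' := by
  induction h generalizing p with
  | slnil => exact le_rfl
  | cons w _ ih => exact (P.polyLength_le_dist_add i p (P.pos i w) _).trans (by
      simpa [polyLength] using ih _)
  | cons_cons w _ ih => simpa [polyLength] using ih _

section Bounds

variable (hlim : thetaLim P.kmax P.smax < Real.pi)
  (hmin : 2 * turnRadius P.kmax P.smax < P.minDist)
include hlim hmin

lemma rmax_pos : 0 < P.rmax :=
  ratioMax_pos P.kmax_pos P.smax_pos hlim
    (by linarith [turnRadius_pos P.kmax_pos P.smax_pos hlim])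

/-- No waypoint is repeated, so the ends of every leg are at least `l_min` apart and the bound for
single legs applies to each of them, whatever its initial orientation. The same holds for the upper
bound below. -/
lemma polyLength_le_pathLength {ws : List (Waypoint nip nt)} (hnd : ws.Nodup) (p : ℂ) (θ : ℝ)
    (hp : ∀ w ∈ ws, P.minDist ≤ dist p (P.pos i w)) :
    P.polyLength i p ws ≤ P.pathLength i p θ ws := by
  induction ws generalizing p θ with
  | nil => exact le_rfl
  | cons w ws ih =>
    rw [List.nodup_cons] at hnd
    have h1 := hp w List.mem_cons_self
    refine add_le_add ?_ (ih hnd.2 _ _ fun w' hw' =>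
      P.minDist_le_pos i fun e => hnd.1 (e ▸ hw'))
    rw [dist_comm, dist_eq_norm] at h1 ⊢
    exact dist_le_legLength P.kmax_pos P.smax_pos hlim (hmin.trans_le h1)

lemma pathLength_le_polyLength {ws : List (Waypoint nip nt)} (hnd : ws.Nodup) (p : ℂ) (θ : ℝ)
    (hp : ∀ w ∈ ws, P.minDist ≤ dist p (P.pos i w)) :
    P.pathLength i p θ ws ≤ P.rmax * P.polyLength i p ws := by
  induction ws generalizing p θ with
  | nil => simp [pathLength, polyLength]
  | cons w ws ih =>
    rw [List.nodup_cons] at hnd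
    have h1 := hp w List.mem_cons_self
    rw [polyLength, mul_add]
    refine add_le_add ?_ (ih hnd.2 _ _ fun w' hw' =>
      P.minDist_le_pos i fun e => hnd.1 (e ▸ hw'))
    rw [dist_comm, dist_eq_norm] at h1 ⊢
    exact legLength_le P.kmax_pos P.smax_pos hlim hmin h1

/-- The weakened arclength of a visitation order that skips some waypoints of another one. -/
lemma arclength_div_le_of_sublist {ws ws' : List (Waypoint nip nt)} (h : ws.Sublist ws')
    (hnd : ws'.Nodup) : P.arclength i ws / P.rmax ≤ P.arclength i ws' := by
  rw [div_le_iff₀ (P.rmax_pos hlim hmin), mul_comm]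
  calc P.arclength i ws ≤ P.rmax * P.polyLength i (P.startPos i) ws :=
        P.pathLength_le_polyLength i hlim hmin (hnd.sublist h) _ _
          fun w _ => P.minDist_le_start i w
    _ ≤ P.rmax * P.polyLength i (P.startPos i) ws' :=
        mul_le_mul_of_nonneg_left (P.polyLength_le_of_sublist i h _) (P.rmax_pos hlim hmin).le
    _ ≤ P.rmax * P.arclength i ws' :=
        mul_le_mul_of_nonneg_left (P.polyLength_le_pathLength i hlim hmin hnd _ _
          fun w _ => P.minDist_le_start i w) (P.rmax_pos hlim hmin).le

end Bounds

/-! ### Weak validity, and existence of weakly optimal orders. -/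

section Admissible

variable {P i} {S : List (Waypoint nip nt) → ℝ} {ξ : Finset (Fin nip)}
  {lam : List (Waypoint nip nt)}

lemma Admissible.nodup (h : P.Admissible i S ξ lam) : lam.Nodup := by
  induction h with
  | root => exact List.nodup_nil
  | child _ hc _ ih =>
    obtain ⟨_, μ, _, hμ, rfl⟩ := hc
    exact List.nodup_append.2 ⟨ih, List.nodup_singleton μ, by
      rintro a ha b hb rfl
      exact hμ (List.mem_singleton.1 hb ▸ ha)⟩

lemma Admissible.allowed (h : P.Admissible i S ξ lam) : ∀ w ∈ lam, Allowed ξ w := by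
  induction h with
  | root => simp
  | child _ hc _ ih =>
    obtain ⟨_, μ, hμ, _, rfl⟩ := hc
    intro w hw
    rcases List.mem_append.1 hw with h | h
    · exact ih w h
    · exact List.mem_singleton.1 h ▸ hμ

/-- Goal nodes have no children, so `f` can only be the last entry. -/
lemma Admissible.isGoal_of_mem (h : P.Admissible i S ξ lam) (hf : Waypoint.final ∈ lam) :
    IsGoal lam := by
  induction h with
  | root => simp at hf
  | child _ hc _ ih =>
    obtain ⟨hg, μ, _, _, rfl⟩ := hc
    rcases List.mem_append.1 hf with h | h
    · exact absurd (ih h) hg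
    · rw [← List.mem_singleton.1 h]
      exact List.getLast?_concat

variable (P i ξ) in
-- Every allocation allows all thermals, so restriction loses no height.
lemma arclengthMax_restrict (lam : List (Waypoint nip nt)) :
    P.arclengthMax i (restrict ξ lam) = P.arclengthMax i lam := by
  unfold arclengthMax
  congr 3
  funext k
  simp [mem_restrict, Allowed]

variable (P i) in
-- Orders without repetition over a finite set of waypoints have bounded length.
lemma finite_admissible (S : List (Waypoint nip nt) → ℝ) (ξ : Finset (Fin nip)) :
    {lam | P.Admissible i S ξ lam}.Finite := by
  have := Fintype.ofFinite (Waypoint nip nt)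
  exact (List.finite_length_le (Waypoint nip nt) (Fintype.card (Waypoint nip nt))).subset
    fun lam h => h.nodup.length_le_card

/-- Valid visitation orders remain weakly valid for smaller allocations. -/
lemma Valid.restrict_weaklyValid (hlim : thetaLim P.kmax P.smax < Real.pi)
    (hmin : 2 * turnRadius P.kmax P.smax < P.minDist) {ξ' : Finset (Fin nip)}
    (h : P.Valid i ξ lam) : P.WeaklyValid i ξ' (restrict ξ' lam) := by
  unfold Valid at h
  induction h with
  | root => exact Admissible.root
  | @child lam lam' hlam hc hS ih =>
    have hnd := (Admissible.child hlam hc hS).nodup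
    obtain ⟨hg, μ, hμ, hmem, rfl⟩ := hc
    -- An allowed waypoint extends the restricted order to a child: the restricted parent is no goal
    -- node, since otherwise it, and hence `lam`, would contain `f`. A waypoint that is not allowed
    -- leaves the restricted order unchanged.
    by_cases ha : Allowed ξ' μ
    · refine Admissible.child ih ⟨fun h' => hg (hlam.isGoal_of_mem
        (mem_restrict.1 (List.mem_of_getLast? h')).1), μ, ha, fun h' => hmem (mem_restrict.1 h').1,
        restrict_append_of_allowed lam ha⟩ ?_
      rw [arclengthMax_restrict]
      exact (P.arclength_div_le_of_sublist i hlim hmin (restrict_sublist _ _) hnd).trans_lt hS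
    · rwa [restrict_append_of_not_allowed _ ha]

/-- A weakly optimal visitation order exists as soon as there is a weakly valid goal node. -/
lemma exists_isWeaklyOptimal (hg : IsGoal lam) (hv : P.WeaklyValid i ξ lam) :
    ∃ μ, P.IsWeaklyOptimal i ξ μ := by
  obtain ⟨μ, hμ, hle⟩ := Set.exists_min_image {μ | IsGoal μ ∧ P.WeaklyValid i ξ μ}
    (P.weakCostL i ξ) ((P.finite_admissible i _ ξ).subset fun _ h => h.2) ⟨lam, hg, hv⟩
  exact ⟨μ, hμ, hle⟩

end Admissible

/-! ### Unvisited points, penalties and the weak cost of a restricted order. -/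

lemma unvisited_eq {ξ : Finset (Fin nip)} (lam : List (Waypoint nip nt)) :
    unvisited lam ξ = ∑ j : Fin nip,
      ((if j ∈ ξ then (1 : ℝ) else 0) - if Waypoint.interest j ∈ lam then 1 else 0) := by
  simp [unvisited, Finset.sum_sub_distrib]

lemma unvisited_nonneg {ξ : Finset (Fin nip)} {lam : List (Waypoint nip nt)}
    (h : ∀ w ∈ lam, Allowed ξ w) : 0 ≤ unvisited lam ξ := by
  rw [unvisited_eq]
  refine Finset.sum_nonneg fun j _ => ?_
  by_cases h1 : Waypoint.interest j ∈ lam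
  · simp [h1, show j ∈ ξ from h _ h1]
  · simp only [h1, if_false, sub_zero]
    split_ifs <;> norm_num

/-- The comparison is made point by point. A visited point of `ξ` contributes 0 before and after, as
it is either kept or leaves order and allocation together; an unvisited point can only leave the
allocation. -/
lemma unvisited_restrict_le {ξ ξ' : Finset (Fin nip)} {lam : List (Waypoint nip nt)}
    (hξ : ξ' ⊆ ξ) (h : ∀ w ∈ lam, Allowed ξ w) :
    unvisited (restrict ξ' lam) ξ' ≤ unvisited lam ξ := by
  rw [unvisited_eq, unvisited_eq]
  refine Finset.sum_le_sum fun j _ => ?_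
  have e : Waypoint.interest j ∈ restrict ξ' lam ↔ Waypoint.interest j ∈ lam ∧ j ∈ ξ' :=
    mem_restrict
  by_cases h1 : Waypoint.interest j ∈ lam
  · by_cases h2 : j ∈ ξ' <;> simp [e, h1, h2, show j ∈ ξ from h _ h1]
  · by_cases h2 : j ∈ ξ'
    · simp [e, h1, h2, hξ h2]
    · simp only [e, h1, h2, and_self, if_false, sub_zero]
      split_ifs <;> norm_num

lemma tan_descent_pos : 0 < Real.tan P.descent :=
  Real.tan_pos_of_pos_of_lt_pi_div_two P.descent_mem.1 P.descent_mem.2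

lemma penaltyL_nonneg : 0 ≤ P.penaltyL i := by
  have := P.startHeight_pos i
  have := Finset.sum_nonneg fun k (_ : k ∈ Finset.univ) => (P.thermalHeight_pos k).le
  have := P.tan_descent_pos
  unfold penaltyL
  positivity

/-- `P_U` contains the start heights of all gliders, `P_L` only one of them. -/
lemma penaltyL_le_penaltyU : P.penaltyL i ≤ P.penaltyU := by
  have := P.tan_descent_pos
  have := Finset.single_le_sum (fun j _ => (P.startHeight_pos j).le) (Finset.mem_univ i)
  unfold penaltyL penaltyU
  gcongr

/-- The weak cost of the allowed part of a valid goal node. -/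
lemma weakCostL_restrict_le (hlim : thetaLim P.kmax P.smax < Real.pi)
    (hmin : 2 * turnRadius P.kmax P.smax < P.minDist) {ξ ξ' : Finset (Fin nip)} (hξ : ξ' ⊆ ξ)
    {lam : List (Waypoint nip nt)} (hg : IsGoal lam) (hv : P.Valid i ξ lam) :
    P.weakCostL i ξ' (restrict ξ' lam)
      ≤ P.arclength i lam + P.penaltyU * unvisited lam ξ := by
  have h0 := unvisited_nonneg hv.allowed
  rw [weakCostL, if_pos (isGoal_restrict ξ' hg)]
  refine add_le_add
    (P.arclength_div_le_of_sublist i hlim hmin (restrict_sublist _ _) hv.nodup) ?_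
  calc unvisited (restrict ξ' lam) ξ' * P.penaltyL i
      ≤ unvisited lam ξ * P.penaltyL i :=
        mul_le_mul_of_nonneg_right (unvisited_restrict_le hξ hv.allowed) (P.penaltyL_nonneg i)
    _ ≤ unvisited lam ξ * P.penaltyU :=
        mul_le_mul_of_nonneg_left (P.penaltyL_le_penaltyU i) h0
    _ = P.penaltyU * unvisited lam ξ := mul_comm _ _

end Scenario

/-! ### Growth of allocations along `Γ_U`, and the comparison of costs. -/

lemma AllocChild.subset {Ξ Ξ' : Fin ng → Finset (Fin nip)} (h : AllocChild Ξ Ξ') (i : Fin ng) :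
    Ξ i ⊆ Ξ' i := by
  obtain ⟨l, ζ, _, rfl⟩ := h
  by_cases hi : i = l
  · subst hi
    simp
  · simp [hi]

lemma IsDescendant.subset {Ξ Ξ' : Fin ng → Finset (Fin nip)} (h : IsDescendant Ξ Ξ')
    (i : Fin ng) : Ξ i ⊆ Ξ' i := by
  induction h with
  | single h => exact h.subset i
  | tail _ h ih => exact ih.trans (h.subset i)

end Orders

end Soaring

theorem mainTheorem1 {nip nt ng : ℕ} (P : Soaring.Scenario nip nt ng)
    (hlim : Soaring.thetaLim P.kmax P.smax < Real.pi)
    (hmin : 2 * Soaring.turnRadius P.kmax P.smax < P.minDist)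
    (Ξ' Ξ'' : Fin ng → Finset (Fin nip))
    (hnode : Soaring.IsAllocNode Ξ') (hdesc : Soaring.IsDescendant Ξ' Ξ'')
    (c : ℝ) (hc : P.HasCost Ξ'' c) :
    (∃ w, P.HasWeakCost Ξ' w) ∧ ∀ w, P.HasWeakCost Ξ' w → w ≤ c := by
  obtain ⟨lam, hlam, rfl⟩ := hc
  have hvalid := fun i => Soaring.Scenario.Valid.restrict_weaklyValid hlim hmin (ξ' := Ξ' i)
    (hlam i).1.2
  have hgoal := fun i => Soaring.isGoal_restrict (Ξ' i) (hlam i).1.1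
  constructor
  · choose μ hμ using fun i =>
      Soaring.Scenario.exists_isWeaklyOptimal (hgoal i) (hvalid i)
    exact ⟨_, μ, hμ, rfl⟩
  · rintro w ⟨μ, hμ, rfl⟩
    -- Distributing `P_U` over the gliders reduces the inequality to one glider at a time, where the
    -- restricted order competes with the weakly optimal one.
    rw [Finset.mul_sum, ← Finset.sum_add_distrib]
    exact Finset.sum_le_sum fun i _ => ((hμ i).2 _ ⟨hgoal i, hvalid i⟩).trans
      (P.weakCostL_restrict_le i hlim hmin (hdesc.subset i) (hlam i).1.1 (hlam i).1.2)
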